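/- Let $L$ be a countable first-order language (relation and function symbols, not necessarily relational, $0$-ary function symbols allowed) with a computable representation, i.e. bijections from disjoint computable sets $R,F\subseteq\omega$ onto the relation symbols and the function symbols of $L$ such that the induced arity map on $R\cup F$ is computable. Let $\mathcal M$ be a computable $L$-structure: its underlying set is a computable subset of $\omega$, and the sets of pairs $(n,\mathbf a)$, $n\in R$, such that the $n$-th relation holds (respectively, fails) at the tuple $\mathbf a$ of $\mathcal M$, and the set of triples $(f,\mathbf a,b)$, $f\in F$, such that the $f$-th function maps $\mathbf a$ to $b$ in $\mathcal M$, are all computably enumerable. Notation. For a finite tuple $\mathbf a$ in $\mathcal M$, $\mathrm{cl}(\mathbf a)$ is the substructure generated by $\mathbf a$. For finite tuples $\mathbf a,\mathbf b$ of the same length, write $\mathbf a\sim\mathbf b$ if $a_i=a_j\Leftrightarrow b_i=b_j$ for all $i,j$, and $\mathbf a\approx\mathbf b$ if $\mathbf a$ and $\mathbf b$ satisfy the same atomic $L$-formulas in $\mathcal M$. $\mathcal M$ is *cofinally ultrahomogeneous* if every finite $A\subseteq\mathcal M$ is contained in a finitely generated substructure $\mathcal B\subseteq\mathcal M$ such that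 every isomorphism from $\mathcal B$ onto a substructure of $\mathcal M$ extends to an automorphism of $\mathcal M$. A *cofinal collection* in $\mathcal M$ is a set $E$ of finite tuples of $\mathcal M$ such that (1) for every finite tuple $\mathbf a$ there is $\mathbf b\in E$ with $\mathbf a\subseteq\mathrm{cl}(\mathbf b)$; (2) if $\mathbf b\in E$ and $\mathbf a\subseteq\mathrm{cl}(\mathbf b)$ is a finite tuple, then the concatenation $\mathbf a\mathbf b$ is in $E$; (3) if $\mathbf a\in E$ and $\mathbf a\approx\mathbf b$, then $\mathbf b\in E$. For an oracle $s$, $\mathcal M$ is *$s$-computably cofinally ultrahomogeneous* if there are an $s$-computable cofinal collection $E$ in $\mathcal M$ and an $s$-computable partial function $g$ whose domain is exactly the set of pairs $(\mathbf a,\mathbf b)$ of tuples in $\mathcal M$ with $\mathbf a\in E$ and $\mathbf a\sim\mathbf b$, such that for each such pair $g(\mathbf a,\mathbf b)$ is an index of an $s$-computable bijection $g_{\mathbf a,\mathbf b}:\mathcal M\to\mathcal M$ with $g_{\mathbf a,\mathbf b}(\mathbf a)=\mathbf b$, and $g_{\mathbf a,\mathbf b}$ is an automorphism of $\mathcal M$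 whenever $\mathbf a\approx\mathbf b$. **Corollary.** If $\mathcal M$ is a computable cofinally ultrahomogeneous $L$-structure, then $\mathcal M$ is $\mathbf 0'''$-computably cofinally ultrahomogeneous, where $\mathbf 0'''$ is the third Turing jump of $\mathbf 0$ (represented by $\emptyset'''$). -/

import Mathlib

open FirstOrder

universe u v

namespace CompFraisse

/-! ### Oracle computation, indices and the Turing jump -/

/-- Programs for partial functions `ℕ →. ℕ` with access to one oracle. -/
inductive OracleCode : Type
  | zero : OracleCode
  | succ : OracleCode
  | left : OracleCode
  | right : OracleCode
  | oracle : OracleCode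
  | pair : OracleCode → OracleCode → OracleCode
  | comp : OracleCode → OracleCode → OracleCode
  | prec : OracleCode → OracleCode → OracleCode
  | rfind : OracleCode → OracleCode

namespace OracleCode

/-- The partial function computed by a program with oracle `o`; the clauses are those of
`Nat.RecursiveIn`. -/
def eval (o : ℕ →. ℕ) : OracleCode → ℕ →. ℕ
  | zero => fun _ => Part.some 0
  | succ => fun n => Part.some (n + 1)
  | left => fun n => Part.some n.unpair.1
  | right => fun n => Part.some n.unpair.2
  | oracle => o
  | pair c d => fun n => Nat.pair <$> eval o c n <*> eval o d n
  | comp c d => fun n => eval o d n >>= eval o c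
  | prec c d => fun p =>
      Nat.rec (eval o c p.unpair.1)
        (fun y IH => IH >>= fun i => eval o d (Nat.pair p.unpair.1 (Nat.pair y i)))
        p.unpair.2
  | rfind c => fun a => Nat.rfind fun n => (fun m => decide (m = 0)) <$> eval o c (Nat.pair a n)

/-- The Gödel number of a program. -/
def toNat : OracleCode → ℕ
  | zero => 0
  | succ => 1
  | left => 2
  | right => 3
  | oracle => 4
  | pair c d => 4 * Nat.pair (toNat c) (toNat d) + 5
  | comp c d => 4 * Nat.pair (toNat c) (toNat d) + 6
  | prec c d => 4 * Nat.pair (toNat c) (toNat d) + 7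
  | rfind c => 4 * toNat c + 8

/-- The program with a given Gödel number. -/
def ofNat : ℕ → OracleCode
  | 0 => zero
  | 1 => succ
  | 2 => left
  | 3 => right
  | 4 => oracle
  | n + 5 =>
    have h : n / 4 < n + 5 := lt_of_le_of_lt (Nat.div_le_self n 4) (by omega)
    have _h1 : (n / 4).unpair.1 < n + 5 := lt_of_le_of_lt (Nat.unpair_left_le _) h
    have _h2 : (n / 4).unpair.2 < n + 5 := lt_of_le_of_lt (Nat.unpair_right_le _) h
    match n % 4 with
    | 0 => pair (ofNat (n / 4).unpair.1) (ofNat (n / 4).unpair.2)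
    | 1 => comp (ofNat (n / 4).unpair.1) (ofNat (n / 4).unpair.2)
    | 2 => prec (ofNat (n / 4).unpair.1) (ofNat (n / 4).unpair.2)
    | _ => rfind (ofNat (n / 4))

theorem ofNat_toNat (c : OracleCode) : ofNat (toNat c) = c := by
  induction c with
  | zero | succ | left | right | oracle => simp [toNat, ofNat]
  | pair c d hc hd =>
    rw [toNat, ofNat]
    simp [hc, hd]
  | comp c d hc hd =>
    have h1 : ∀ m, (4 * m + 1) / 4 = m := by omega
    have h2 : ∀ m, (4 * m + 1) % 4 = 1 := by omega
    rw [toNat, ofNat]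
    simp [hc, hd, h1, h2]
  | prec c d hc hd =>
    have h1 : ∀ m, (4 * m + 2) / 4 = m := by omega
    have h2 : ∀ m, (4 * m + 2) % 4 = 2 := by omega
    rw [toNat, ofNat]
    simp [hc, hd, h1, h2]
  | rfind c hc =>
    have h1 : ∀ m, (4 * m + 3) / 4 = m := by omega
    have h2 : ∀ m, (4 * m + 3) % 4 = 3 := by omega
    rw [toNat, ofNat]
    simp [hc, h1, h2]

/-- The partial functions computed by programs with oracle `o` are those recursive in `o`. -/
theorem recursiveIn_iff_exists_eval {o f : ℕ →. ℕ} :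
    Nat.RecursiveIn {o} f ↔ ∃ c : OracleCode, eval o c = f := by
  constructor
  · intro h
    induction h with
    | zero => exact ⟨zero, rfl⟩
    | succ => exact ⟨succ, rfl⟩
    | left => exact ⟨left, rfl⟩
    | right => exact ⟨right, rfl⟩
    | oracle g hg => exact ⟨oracle, (Set.mem_singleton_iff.mp hg).symm⟩
    | pair _ _ hf hh =>
      obtain ⟨c, rfl⟩ := hf
      obtain ⟨d, rfl⟩ := hh
      exact ⟨pair c d, rfl⟩
    | comp _ _ hf hh =>
      obtain ⟨c, rfl⟩ := hf
      obtain ⟨d, rfl⟩ := hh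
      exact ⟨comp c d, rfl⟩
    | prec _ _ hf hh =>
      obtain ⟨c, rfl⟩ := hf
      obtain ⟨d, rfl⟩ := hh
      exact ⟨prec c d, rfl⟩
    | rfind _ hf =>
      obtain ⟨c, rfl⟩ := hf
      exact ⟨rfind c, rfl⟩
  · rintro ⟨c, rfl⟩
    induction c with
    | zero => exact .zero
    | succ => exact .succ
    | left => exact .left
    | right => exact .right
    | oracle => exact .oracle _ rfl
    | pair c d hc hd => exact .pair hc hd
    | comp c d hc hd => exact .comp hc hd
    | prec c d hc hd => exact .prec hc hd
    | rfind c hc => exact .rfind hc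

end OracleCode

open Classical in
/-- The characteristic function of a set of natural numbers, as an oracle. -/
noncomputable def charOracle (s : Set ℕ) : ℕ →. ℕ := fun n => Part.some (if n ∈ s then 1 else 0)

/-- The `e`-th partial function computable with oracle `s`, i.e. `{e}^s`. -/
noncomputable def phi (s : Set ℕ) (e : ℕ) : ℕ →. ℕ := (OracleCode.ofNat e).eval (charOracle s)

/-- The Turing jump of a set of natural numbers. -/
def jump (s : Set ℕ) : Set ℕ := {e | (phi s e e).Dom}

/-- An `s`-computable partial function. -/
def PartialComputableIn {α σ : Type*} [Primcodable α] [Primcodable σ] (s : Set ℕ) (f : α →. σ) :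
    Prop := RecursiveIn {charOracle s} f

open Classical in
/-- An `s`-computable set. -/
def SetComputableIn {α : Type*} [Primcodable α] (s : Set ℕ) (X : Set α) : Prop :=
  ComputableIn {charOracle s} fun x => decide (x ∈ X)

/-! ### Computable languages and computable structures -/


/-- A computable representation of a language: numberings of the relation symbols and of the
function symbols by disjoint computable sets, with a computable arity function. -/
structure LanguageRep (L : FirstOrder.Language.{u, v}) where
  relDom : Set ℕ
  funDom : Set ℕ
  rel : relDom ≃ Σ k, L.Relations k
  func : funDom ≃ Σ k, L.Functions k
  relDom_computable : ComputablePred fun n => n ∈ relDom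
  funDom_computable : ComputablePred fun n => n ∈ funDom
  disjoint : Disjoint relDom funDom
  arity_computable : ∃ ar : ℕ → ℕ, Computable ar ∧
    (∀ r : relDom, ar r = (rel r).1) ∧ (∀ f : funDom, ar f = (func f).1)

/-- The underlying tuple of numbers of a finite tuple of elements of a set of numbers. -/
def toNatList {M : Set ℕ} (a : List M) : List ℕ := a.map fun x => (x : ℕ)

section Structures

variable {L : FirstOrder.Language.{u, v}} (ρ : LanguageRep L) (M : Set ℕ) [L.Structure M]

/-- The coded positive atomic facts about the relations. -/
def posDiagram : Set (ℕ × List ℕ) :=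
  {p | ∃ (r : ρ.relDom) (a : Fin (ρ.rel r).1 → M),
    FirstOrder.Language.Structure.RelMap (ρ.rel r).2 a ∧ p = ((r : ℕ), toNatList (List.ofFn a))}

/-- The coded negative atomic facts about the relations. -/
def negDiagram : Set (ℕ × List ℕ) :=
  {p | ∃ (r : ρ.relDom) (a : Fin (ρ.rel r).1 → M),
    ¬ FirstOrder.Language.Structure.RelMap (ρ.rel r).2 a ∧ p = ((r : ℕ), toNatList (List.ofFn a))}

/-- The coded graphs of the functions. -/
def funDiagram : Set (ℕ × List ℕ × ℕ) :=
  {p | ∃ (f : ρ.funDom) (a : Fin (ρ.func f).1 → M),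
    p = ((f : ℕ), toNatList (List.ofFn a),
      ((FirstOrder.Language.Structure.funMap (ρ.func f).2 a : M) : ℕ))}

/-- A computable structure: its underlying set is a computable subset of `ℕ`, and its coded
relations, their complements, and its coded functions are computably enumerable. -/
structure IsComputableStructure : Prop where
  dom : ComputablePred fun n => n ∈ M
  pos : REPred fun p => p ∈ posDiagram ρ M
  neg : REPred fun p => p ∈ negDiagram ρ M
  func : REPred fun p => p ∈ funDiagram ρ M

end Structures

/-! ### Cofinal ultrahomogeneity -/

section Homogeneity

/-- The tuples have the same length and the same pattern of equalities among coordinates. -/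
def TupleSim {M N : Type*} (a : List M) (b : List N) : Prop :=
  ∃ h : a.length = b.length, ∀ i j : Fin a.length,
    a.get i = a.get j ↔ b.get (i.cast h) = b.get (j.cast h)

variable (L : FirstOrder.Language.{u, v})

/-- The tuples have the same length and satisfy the same atomic formulas of `L`. -/
def ClSim {M N : Type*} [L.Structure M] [L.Structure N] (a : List M) (b : List N) : Prop :=
  ∃ h : a.length = b.length, ∀ φ : L.Formula (Fin a.length), φ.IsAtomic →
    (φ.Realize a.get ↔ φ.Realize fun i => b.get (i.cast h))

/-- The substructure generated by a finite tuple. -/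
def cl {M : Type*} [L.Structure M] (a : List M) : L.Substructure M :=
  FirstOrder.Language.Substructure.closure L {x | x ∈ a}

/-- A structure is cofinally ultrahomogeneous if every finite subset lies in a finitely generated
substructure all of whose isomorphisms onto substructures extend to automorphisms. -/
def CofinallyUltrahomogeneous (M : Type*) [L.Structure M] : Prop :=
  ∀ A : Set M, A.Finite → ∃ B : L.Substructure M, B.FG ∧ A ⊆ B ∧
    ∀ (B' : L.Substructure M) (f : B ≃[L] B'), ∃ F : M ≃[L] M, ∀ x : B, F x = f x

/-- A cofinal collection of finite tuples in a structure. -/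
structure IsCofinalCollection {M : Type*} [L.Structure M] (E : Set (List M)) : Prop where
  cofinal : ∀ a : List M, ∃ b ∈ E, ∀ x ∈ a, x ∈ cl L b
  append : ∀ b ∈ E, ∀ a : List M, (∀ x ∈ a, x ∈ cl L b) → a ++ b ∈ E
  clSim : ∀ a ∈ E, ∀ b : List M, ClSim L a b → b ∈ E

/-- `g` witnesses that `M` is `s`-computably cofinally ultrahomogeneous with respect to `E`. -/
structure IsHomogeneityWitness (s M : Set ℕ) [L.Structure M] (E : Set (List M))
    (g : List ℕ × List ℕ →. ℕ) : Prop where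
  computable : PartialComputableIn s g
  dom : ∀ p, (g p).Dom ↔ ∃ a ∈ E, ∃ b : List M, TupleSim a b ∧ p = (toNatList a, toNatList b)
  /-- `g (a, b)` is an index of an `s`-computable bijection `σ` of `M` with `σ a = b`, which is an
  automorphism when `a` and `b` satisfy the same atomic formulas. -/
  index : ∀ a ∈ E, ∀ b : List M, TupleSim a b → ∀ e ∈ g (toNatList a, toNatList b),
    ∃ σ : M ≃ M,
      (∀ n, (phi s e n).Dom ↔ n ∈ M) ∧ (∀ x : M, ((σ x : M) : ℕ) ∈ phi s e x) ∧
      a.map σ = b ∧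
      (ClSim L a b → ∃ F : M ≃[L] M, ∀ x, F x = σ x)

/-- `M` is `s`-computably cofinally ultrahomogeneous. -/
def ComputablyCofinallyUltrahomogeneous (s M : Set ℕ) [L.Structure M] : Prop :=
  ∃ E : Set (List M), IsCofinalCollection L E ∧ SetComputableIn s (toNatList '' E) ∧
    ∃ g : List ℕ × List ℕ →. ℕ, IsHomogeneityWitness L s M E g

end Homogeneity

end CompFraisse

/-! The cofinal collection consists of the homogeneous tuples: those `a` for which every isomorphism
from the substructure generated by `a` onto a substructure extends to an automorphism. Such
isomorphisms are coded by finite lists of pairs, and the task is to bound the complexity of two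
conditions on these codes.

A list of pairs fails to generate a partial isomorphism exactly when some finite derivation of
generated pairs exhibits a conflict in equality or in a relation. The relations, their complements
and the function graphs are c.e., so such a certificate can be recognised effectively, and being a
partial isomorphism is decidable in the first jump (`isPartialIso_iff_not_isMismatch`).

Homogeneity as defined speaks of automorphisms, which are infinite objects. Cofinal ultrahomogeneity
removes them (`isHomogeneousTuple_iff`): `a` is homogeneous iff every partial isomorphism on `a`
extends to any further finite tuple of domain elements. Extending to a homogeneous tuple that
generates `a` already gives the automorphism. This is a `∀∃` statement over a matrix decidable in
the first jump, hence decidable in the third.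

With that oracle a back-and-forth search constructs the bijections. Starting from the pairing of `a`
with `b`, it moves through partial isomorphisms with homogeneous domain if the pairing is a partial
isomorphism, and through partial injections otherwise. The oracle decides which case holds, so one
procedure serves both, and the parameter theorem yields its index. -/

namespace CompFraisse

/-! ### Closure properties of relative computability. -/

section OracleToolkit

open Encodable

variable {α β γ σ : Type*} [Primcodable α] [Primcodable β] [Primcodable γ] [Primcodable σ]
variable {O : Set (ℕ →. ℕ)}

theorem _root_.RecursiveIn.comp {f : β →. σ} {g : α → β} (hf : RecursiveIn O f)
    (hg : ComputableIn O g) : RecursiveIn O fun a => f (g a) :=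
  (Nat.RecursiveIn.comp hf hg).of_eq fun n => by
    rcases e : decode (α := α) n with - | a <;> simp [encodek]

theorem _root_.RecursiveIn.bind {f : α →. β} {g : α × β →. σ} (hf : RecursiveIn O f)
    (hg : RecursiveIn O g) : RecursiveIn O fun a => (f a).bind fun b => g (a, b) :=
  (Nat.RecursiveIn.comp hg (Nat.RecursiveIn.pair Nat.Partrec.some.recursiveIn hf)).of_eq
    fun n => by
      rcases e : decode (α := α) n <;> simp [Seq.seq, e, encodek]

theorem _root_.RecursiveIn.map {f : α →. β} {g : α × β → σ} (hf : RecursiveIn O f)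
    (hg : ComputableIn O g) : RecursiveIn O fun a => (f a).map fun b => g (a, b) := by
  simpa [Part.bind_some_eq_map] using RecursiveIn.bind hf hg.recursiveIn

theorem _root_.ComputableIn.comp {f : β → σ} {g : α → β} (hf : ComputableIn O f)
    (hg : ComputableIn O g) : ComputableIn O fun a => f (g a) :=
  RecursiveIn.comp (f := fun b => Part.some (f b)) hf hg

theorem _root_.ComputableIn.pair {f : α → β} {g : α → γ} (hf : ComputableIn O f)
    (hg : ComputableIn O g) : ComputableIn O fun a => (f a, g a) := by
  -- Pairing is obtained from two binds, each keeping its input; this yields the components in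
  -- reverse order, and `h3` swaps them.
  have h1 : RecursiveIn O fun a : α × β => Part.some (g a.1, a.2) := by
    have := RecursiveIn.bind (O := O) (f := fun a : α × β => Part.some (g a.1))
      (g := fun p : (α × β) × γ => Part.some (p.2, p.1.2)) (hg.comp ComputableIn.fst)
      ((Primrec.pair Primrec.snd (Primrec.snd.comp Primrec.fst)).computableIn)
    simpa using this
  have h2 := RecursiveIn.bind hf h1
  have h3 : ComputableIn O fun p : γ × β => (p.2, p.1) :=
    (Primrec.pair Primrec.snd Primrec.fst).computableIn
  refine h3.comp (g := fun a => (g a, f a)) ?_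
  simpa [ComputableIn] using h2

theorem _root_.RecursiveIn.rfind {p : α × ℕ → Bool} (hp : ComputableIn O p) :
    RecursiveIn O fun a => Nat.rfind fun n => Part.some (p (a, n)) := by
  -- The underlying minimisation looks for a zero, so `true` is coded by `0`.
  have h : ComputableIn O fun q : α × ℕ => cond (p q) 0 1 :=
    ((Primrec.dom_bool fun b => cond b 0 1).computableIn).comp hp
  refine (Nat.RecursiveIn.rfind h).of_eq fun n => ?_
  rcases e : decode (α := α) n with - | a
  · simpa [e] using Nat.rfind_zero_none _ rfl
  · simp only [Part.coe_some, Part.bind_some, Part.map_eq_map]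
    rw [Part.map_id' (f := encode) (fun _ => rfl)]
    congr 1
    funext m
    have : decode (α := α × ℕ) (Nat.pair n m) = some (a, m) := by simp [e]
    rw [this]
    cases h : p (a, m) <;> simp [h]

theorem _root_.RecursiveIn.nat_rec {f : α → ℕ} {g : α →. σ} {h : α × ℕ × σ →. σ}
    (hf : ComputableIn O f) (hg : RecursiveIn O g) (hh : RecursiveIn O h) :
    RecursiveIn O fun a => Nat.rec (motive := fun _ => Part σ) (g a)
      (fun y IH => IH.bind fun i => h (a, y, i)) (f a) :=
  (Nat.RecursiveIn.comp (Nat.RecursiveIn.prec hg hh)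
      (Nat.RecursiveIn.pair Nat.Partrec.some.recursiveIn hf)).of_eq fun n => by
    rcases e : decode (α := α) n with - | a
    · simp [Seq.seq]
    · simp only [Seq.seq, Part.coe_some, Part.bind_some]
      simp
      induction f a <;> simp_all

theorem _root_.ComputableIn.cond {c : α → Bool} {f g : α → σ} (hc : ComputableIn O c)
    (hf : ComputableIn O f) (hg : ComputableIn O g) :
    ComputableIn O fun a => cond (c a) (f a) (g a) :=
  (Primrec.cond Primrec.fst (Primrec.fst.comp Primrec.snd)
    (Primrec.snd.comp Primrec.snd)).computableIn.comp (hc.pair (hf.pair hg))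

end OracleToolkit

/-! ### Relative decidability, indices, and the cost of a quantifier. -/

section DecIn

open Encodable

variable {α β γ σ : Type*} [Primcodable α] [Primcodable β] [Primcodable γ] [Primcodable σ]
variable {s : Set ℕ}

/-- A predicate decidable with oracle `s`. -/
def DecIn (s : Set ℕ) (P : α → Prop) : Prop := SetComputableIn s {x | P x}

theorem decIn_iff {P : α → Prop} : DecIn s P ↔
    ∃ d : α → Bool, ComputableIn {charOracle s} d ∧ ∀ a, d a = true ↔ P a := by
  classical
  constructor
  · intro h
    exact ⟨_, h, fun a => by simp⟩
  · rintro ⟨d, hd, h⟩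
    have : d = fun a => decide (a ∈ {x | P x}) := by
      funext a
      rw [Bool.eq_iff_iff, h]
      simp
    rw [this] at hd
    unfold DecIn SetComputableIn
    convert hd

theorem DecIn.of_iff {P Q : α → Prop} (h : DecIn s P) (e : ∀ a, Q a ↔ P a) : DecIn s Q := by
  rwa [show Q = P from funext fun a => propext (e a)]

theorem DecIn.comp {P : β → Prop} (h : DecIn s P) {f : α → β} (hf : Primrec f) :
    DecIn s fun a => P (f a) := by
  obtain ⟨d, hd, h⟩ := decIn_iff.1 h
  exact decIn_iff.2 ⟨_, hd.comp hf.computableIn, fun a => h _⟩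

theorem DecIn.and {P Q : α → Prop} (hP : DecIn s P) (hQ : DecIn s Q) :
    DecIn s fun a => P a ∧ Q a := by
  obtain ⟨d, hd, h⟩ := decIn_iff.1 hP
  obtain ⟨d', hd', h'⟩ := decIn_iff.1 hQ
  exact decIn_iff.2 ⟨_, Primrec.and.computableIn₂.comp (hd.pair hd'), fun a => by simp [h, h']⟩

theorem DecIn.not {P : α → Prop} (hP : DecIn s P) : DecIn s fun a => ¬ P a := by
  obtain ⟨d, hd, h⟩ := decIn_iff.1 hP
  exact decIn_iff.2 ⟨_, Primrec.not.computableIn.comp hd, fun a => by simp [← h]⟩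

theorem DecIn.imp {P Q : α → Prop} (hP : DecIn s P) (hQ : DecIn s Q) :
    DecIn s fun a => P a → Q a :=
  (hP.and hQ.not).not.of_iff fun a => by tauto

theorem _root_.ComputablePred.decIn {P : α → Prop} (hP : ComputablePred P) : DecIn s P := by
  obtain ⟨i, h⟩ := hP
  exact decIn_iff.2 ⟨_, h.computableIn, fun a => by simp⟩

theorem _root_.PrimrecPred.decIn {P : α → Prop} (hP : PrimrecPred P) : DecIn s P :=
  hP.computablePred.decIn

/-- The first `b` with `P (a, b)`. -/
theorem DecIn.exists_search [Inhabited β] {P : α × β → Prop} (hP : DecIn s P) :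
    ∃ F : α →. β, RecursiveIn {charOracle s} F ∧ (∀ a, (F a).Dom ↔ ∃ b, P (a, b)) ∧
      ∀ a, ∀ b ∈ F a, P (a, b) := by
  obtain ⟨d, hd, h⟩ := decIn_iff.1 hP
  have hdec : Primrec fun q : α × ℕ => decode (α := β) q.2 := Primrec.decode.comp Primrec.snd
  have hget : Primrec fun q : α × ℕ => (decode (α := β) q.2).getD default :=
    Primrec.option_getD.comp hdec (Primrec.const _)
  -- The search runs over codes. The guard rejects numbers that code nothing, so `default` never
  -- produces a false hit.
  let e : α × ℕ → Bool := fun q =>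
    cond (decode (α := β) q.2).isSome (d (q.1, (decode q.2).getD default)) false
  have he : ComputableIn {charOracle s} e :=
    ComputableIn.cond (Primrec.option_isSome.comp hdec).computableIn
      (hd.comp (Primrec.pair Primrec.fst hget).computableIn) (ComputableIn.const _)
  have key : ∀ a n, true ∈ Part.some (e (a, n)) ↔
      ∃ b, decode (α := β) n = some b ∧ P (a, b) := by
    intro a n
    rw [Part.mem_some_iff, eq_comm]
    cases hb : decode (α := β) n <;> simp [e, hb, ← h]
  refine ⟨fun a => (Nat.rfind fun n => Part.some (e (a, n))).map
    fun n => (decode (α := β) n).getD default,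
    RecursiveIn.map (RecursiveIn.rfind he) hget.computableIn, fun a => ?_, fun a b hb => ?_⟩
  · refine Nat.rfind_dom'.trans ?_
    constructor
    · rintro ⟨n, hn, -⟩
      obtain ⟨b, -, hb⟩ := (key a n).1 hn
      exact ⟨b, hb⟩
    · rintro ⟨b, hb⟩
      exact ⟨encode b, (key a _).2 ⟨b, encodek b, hb⟩, fun _ => trivial⟩
  · obtain ⟨n, hn, rfl⟩ := (Part.mem_map_iff _).1 hb
    obtain ⟨b, hb, hP⟩ := (key a n).1 (Nat.rfind_spec hn)
    simpa [hb] using hP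

/-- The index of the program which ignores its input and returns `n`. -/
def constIndex : ℕ → ℕ
  | 0 => 0
  -- Here `1` is the number of `succ`, and `4 * _ + 6` is the numbering of `comp`.
  | n + 1 => 4 * Nat.pair 1 (constIndex n) + 6

theorem constIndex_primrec : Primrec constIndex := by
  have : Primrec fun n : ℕ => Nat.rec (motive := fun _ => ℕ) 0
      (fun _ i => 4 * Nat.pair 1 i + 6) n :=
    Primrec.nat_rec₁ 0 ((Primrec.nat_add.comp (Primrec.nat_mul.comp (Primrec.const 4)
      (Primrec₂.natPair.comp (Primrec.const 1) Primrec.snd)) (Primrec.const 6)).to₂)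
  refine this.of_eq fun n => ?_
  induction n with
  | zero => rfl
  | succ n ih => simp only [constIndex, ← ih]

theorem constIndex_eval (o : ℕ →. ℕ) (n m : ℕ) :
    (OracleCode.ofNat (constIndex n)).eval o m = Part.some n := by
  suffices ∃ c : OracleCode, c.toNat = constIndex n ∧ c.eval o m = Part.some n by
    obtain ⟨c, hc, h⟩ := this
    rw [← hc, OracleCode.ofNat_toNat, h]
  induction n with
  | zero => exact ⟨.zero, rfl, rfl⟩
  | succ n ih =>
    obtain ⟨c, hc, h⟩ := ih
    exact ⟨.comp .succ c, by simp [OracleCode.toNat, constIndex, hc],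
      by simp [OracleCode.eval, h]⟩

/-- Allows an index to be assembled arithmetically around an arbitrary number `e`. -/
theorem ofNat_comp_index (c : OracleCode) (e : ℕ) :
    OracleCode.ofNat (4 * Nat.pair c.toNat e + 6) = .comp c (OracleCode.ofNat e) := by
  have h1 : ∀ m, (4 * m + 1) / 4 = m := by omega
  have h2 : ∀ m, (4 * m + 1) % 4 = 1 := by omega
  rw [OracleCode.ofNat]
  simp [h1, h2, OracleCode.ofNat_toNat]

theorem ofNat_pair_index (e e' : ℕ) :
    OracleCode.ofNat (4 * Nat.pair e e' + 5) =
      .pair (OracleCode.ofNat e) (OracleCode.ofNat e') := by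
  rw [OracleCode.ofNat]
  simp

/-- The parameter theorem for one parameter. -/
theorem exists_index {f : α × ℕ →. ℕ} (hf : RecursiveIn {charOracle s} f) :
    ∃ h : α → ℕ, Primrec h ∧ ∀ a n, phi s (h a) n = f (a, n) := by
  obtain ⟨c, hc⟩ := OracleCode.recursiveIn_iff_exists_eval.1 hf
  -- Unpairing and pairing again is the identity program. The index below is that of `c` applied to
  -- the pair of the constant `encode a` and the input.
  let e' := (OracleCode.pair .left .right).toNat
  refine ⟨fun a => 4 * Nat.pair c.toNat (4 * Nat.pair (constIndex (encode a)) e' + 5) + 6,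
    ?_, fun a n => ?_⟩
  · exact Primrec.nat_add.comp (Primrec.nat_mul.comp (Primrec.const 4)
      (Primrec₂.natPair.comp (Primrec.const _) (Primrec.nat_add.comp
        (Primrec.nat_mul.comp (Primrec.const 4) (Primrec₂.natPair.comp
          (constIndex_primrec.comp Primrec.encode) (Primrec.const _))) (Primrec.const 5))))
      (Primrec.const 6)
  · rw [phi, ofNat_comp_index, ofNat_pair_index]
    simp only [OracleCode.eval, constIndex_eval, e', OracleCode.ofNat_toNat]
    simp [Seq.seq, hc, Part.map_id']

/-- Domains of `s`-computable partial functions are decidable with oracle `jump s`. -/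
theorem decIn_jump_of_dom {f : α →. β} (hf : RecursiveIn {charOracle s} f) :
    DecIn (jump s) fun a => (f a).Dom := by
  -- The numerical input is ignored, so the diagonal computation deciding `h a ∈ jump s` halts
  -- exactly when `f a` does.
  have hf' : RecursiveIn {charOracle s} fun q : α × ℕ => (f q.1).map fun _ => 0 :=
    RecursiveIn.map (g := fun _ : (α × ℕ) × β => (0 : ℕ)) (hf.comp ComputableIn.fst)
      (ComputableIn.const 0)
  obtain ⟨h, hh, he⟩ := exists_index hf'
  classical
  have hor : ComputableIn {charOracle (jump s)} fun n => if n ∈ jump s then 1 else 0 := by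
    have := RecursiveIn.oracle (O := {charOracle (jump s)}) _ rfl
    refine this.of_eq fun n => ?_
    unfold charOracle
    congr
  have heq : Primrec fun n : ℕ => decide (n = 1) :=
    PrimrecPred.decide (Primrec.eq.comp Primrec.id (Primrec.const 1))
  refine decIn_iff.2 ⟨_, heq.computableIn.comp (hor.comp hh.computableIn), fun a => ?_⟩
  have : h a ∈ jump s ↔ (f a).Dom := by
    change (phi s (h a) (h a)).Dom ↔ _
    rw [he]
    rfl
  simp [this]

/-- An unbounded existential quantifier costs one jump. -/
theorem DecIn.exists [Inhabited β] {P : α × β → Prop} (hP : DecIn s P) :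
    DecIn (jump s) fun a => ∃ b, P (a, b) := by
  obtain ⟨F, hF, hd, -⟩ := hP.exists_search
  exact (decIn_jump_of_dom hF).of_iff fun a => (hd a).symm

/-- A dummy existential quantifier reduces this to `DecIn.exists`. -/
theorem DecIn.jump {P : α → Prop} (hP : DecIn s P) : DecIn (jump s) P :=
  (DecIn.exists (β := ℕ) (hP.comp Primrec.fst)).of_iff fun _ => by simp

/-- Semidecidable predicates are projections of primitive recursive ones. -/
theorem _root_.REPred.exists_stage {P : α → Prop} (hP : REPred P) :
    ∃ q : ℕ × α → Prop, PrimrecPred q ∧ ∀ a, P a ↔ ∃ k, q (k, a) := by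
  obtain ⟨c, hc⟩ := Nat.Partrec.Code.exists_code.1 hP
  refine ⟨fun p => (Nat.Partrec.Code.evaln p.1 c (encode p.2)).isSome = true, ?_, fun a => ?_⟩
  · exact Primrec.eq.comp (Primrec.option_isSome.comp (Nat.Partrec.Code.primrec_evaln.comp
      (Primrec.pair (Primrec.pair Primrec.fst (Primrec.const c))
        (Primrec.encode.comp Primrec.snd)))) (Primrec.const true)
  · have h1 : P a ↔ (c.eval (encode a)).Dom := by
      rw [hc]
      simp [Part.assert, encodek]
    rw [h1, Part.dom_iff_mem]
    simp only [Nat.Partrec.Code.evaln_complete, Option.isSome_iff_exists, Option.mem_def]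
    exact exists_comm

end DecIn

/-! ### Finite partial isomorphisms, homogeneous tuples and back-and-forth. -/

section PartialIsomorphisms

open FirstOrder.Language FirstOrder.Language.Structure

variable (L : FirstOrder.Language.{u, v}) {M : Type*} [L.Structure M]

/-- The substructure of the square of `M` generated by a list of pairs. -/
inductive PairGen (Z : List (M × M)) : M × M → Prop
  | base (p : M × M) : p ∈ Z → PairGen Z p
  | func {k : ℕ} (f : L.Functions k) (ps : Fin k → M × M) : (∀ i, PairGen Z (ps i)) →
      PairGen Z (funMap f fun i => (ps i).1, funMap f fun i => (ps i).2)

/-- The list of pairs generates an isomorphism between finitely generated substructures. -/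
structure IsPartialIso (Z : List (M × M)) : Prop where
  eq_iff : ∀ p q, PairGen L Z p → PairGen L Z q → (p.1 = q.1 ↔ p.2 = q.2)
  rel_iff : ∀ (k : ℕ) (r : L.Relations k) (ps : Fin k → M × M), (∀ i, PairGen L Z (ps i)) →
    (RelMap r (fun i => (ps i).1) ↔ RelMap r fun i => (ps i).2)

/-- The pairs form the graph of an injective partial function. -/
def IsPartialInj {M : Type*} (Z : List (M × M)) : Prop :=
  ∀ p ∈ Z, ∀ q ∈ Z, (p.1 = q.1 ↔ p.2 = q.2)

variable {L}

theorem IsPartialIso.isPartialInj {Z : List (M × M)} (h : IsPartialIso L Z) : IsPartialInj Z :=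
  fun p hp q hq => h.eq_iff p q (.base p hp) (.base q hq)

theorem PairGen.mono {Z Y : List (M × M)} (h : ∀ p ∈ Z, PairGen L Y p) {p : M × M}
    (hp : PairGen L Z p) : PairGen L Y p := by
  induction hp with
  | base p hp => exact h p hp
  | func f ps _ ih => exact .func f ps ih

theorem IsPartialIso.of_pairGen {Z Y : List (M × M)} (hY : IsPartialIso L Y)
    (h : ∀ p ∈ Z, PairGen L Y p) : IsPartialIso L Z :=
  ⟨fun p q hp hq => hY.eq_iff p q (hp.mono h) (hq.mono h),
    fun k r ps hps => hY.rel_iff k r ps fun i => (hps i).mono h⟩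

theorem IsPartialIso.mono {Z Y : List (M × M)} (hY : IsPartialIso L Y) (h : Z ⊆ Y) :
    IsPartialIso L Z :=
  hY.of_pairGen fun p hp => .base p (h hp)

theorem mem_zip_iff_get {M N : Type*} {a : List M} {b : List N} (h : a.length = b.length)
    {p : M × N} : p ∈ a.zip b ↔ ∃ i : Fin a.length, (a.get i, b.get (i.cast h)) = p := by
  rw [List.mem_iff_get]
  constructor
  · rintro ⟨i, rfl⟩
    exact ⟨⟨i, by have := i.2; simp at this; omega⟩, by simp⟩
  · rintro ⟨i, rfl⟩
    exact ⟨⟨i, by have := i.2; simp; omega⟩, by simp⟩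

/-- Trades two tuples of equal length for one list of pairs, so that casts between index types
disappear. -/
theorem exists_zip_iff {M N : Type*} {a : List M} {b : List N} {P : List (M × N) → Prop} :
    (∃ Z : List (M × N), Z.map Prod.fst = a ∧ Z.map Prod.snd = b ∧ P Z) ↔
      a.length = b.length ∧ P (a.zip b) := by
  constructor
  · rintro ⟨Z, rfl, rfl, h⟩
    refine ⟨by simp, ?_⟩
    rwa [List.zip_map', List.map_id']
  · rintro ⟨h, hP⟩
    exact ⟨a.zip b, List.map_fst_zip h.le, List.map_snd_zip h.ge, hP⟩

theorem tupleSim_iff {M : Type*} {a b : List M} : TupleSim a b ↔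
    ∃ Z : List (M × M), Z.map Prod.fst = a ∧ Z.map Prod.snd = b ∧ IsPartialInj Z := by
  rw [exists_zip_iff, TupleSim]
  constructor
  · rintro ⟨h, hs⟩
    refine ⟨h, fun p hp q hq => ?_⟩
    obtain ⟨i, rfl⟩ := (mem_zip_iff_get h).1 hp
    obtain ⟨j, rfl⟩ := (mem_zip_iff_get h).1 hq
    exact hs i j
  · rintro ⟨h, hs⟩
    exact ⟨h, fun i j => hs _ ((mem_zip_iff_get h).2 ⟨i, rfl⟩) _ ((mem_zip_iff_get h).2 ⟨j, rfl⟩)⟩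

/-- Each generation step applies one symbol to both coordinates, so a generated pair is a single
term evaluated at the two tuples. The summand `Fin 0` is the empty type of bound variables. -/
theorem pairGen_zip_iff {a b : List M} (h : a.length = b.length) {p : M × M} :
    PairGen L (a.zip b) p ↔ ∃ t : L.Term (Fin a.length ⊕ Fin 0),
      (t.realize (Sum.elim a.get default), t.realize
        (Sum.elim (fun i => b.get (i.cast h)) default)) = p := by
  constructor
  · intro hp
    induction hp with
    | base p hp =>
      obtain ⟨i, rfl⟩ := (mem_zip_iff_get h).1 hp
      exact ⟨.var (Sum.inl i), rfl⟩
    | func f ps _ ih =>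
      choose t ht using ih
      refine ⟨.func f t, ?_⟩
      simp only [Term.realize_func, ← ht]
  · rintro ⟨t, rfl⟩
    induction t with
    | var i =>
      rcases i with i | i
      · exact .base _ ((mem_zip_iff_get h).2 ⟨i, rfl⟩)
      · exact i.elim0
    | func f ts ih => exact .func f _ ih

/-- Atomic formulas compare or relate values of terms, and the pairs of values of terms are the
generated pairs. -/
theorem clSim_iff {a b : List M} : ClSim L a b ↔
    ∃ Z : List (M × M), Z.map Prod.fst = a ∧ Z.map Prod.snd = b ∧ IsPartialIso L Z := by
  rw [exists_zip_iff, ClSim]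
  constructor
  · rintro ⟨h, hs⟩
    refine ⟨h, fun p q hp hq => ?_, fun k r ps hps => ?_⟩
    · obtain ⟨t, rfl⟩ := (pairGen_zip_iff h).1 hp
      obtain ⟨t', rfl⟩ := (pairGen_zip_iff h).1 hq
      simpa [Formula.Realize] using hs (t.bdEqual t') (.equal t t')
    · choose t ht using fun i => (pairGen_zip_iff h).1 (hps i)
      have := hs (r.boundedFormula t) (.rel r t)
      simp only [Formula.Realize, BoundedFormula.realize_rel] at this
      simpa only [← ht] using this
  · rintro ⟨h, hs⟩
    refine ⟨h, fun φ hφ => ?_⟩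
    cases hφ with
    | equal t t' =>
      simpa [Formula.Realize] using hs.eq_iff _ _ ((pairGen_zip_iff h).2 ⟨t, rfl⟩)
        ((pairGen_zip_iff h).2 ⟨t', rfl⟩)
    | rel r t =>
      simp only [Formula.Realize, BoundedFormula.realize_rel]
      exact hs.rel_iff _ r _ fun i => (pairGen_zip_iff h).2 ⟨t i, rfl⟩

theorem PairGen.snd_eq {Z : List (M × M)} {F : M ≃[L] M} (hF : ∀ p ∈ Z, p.2 = F p.1) {p : M × M}
    (hp : PairGen L Z p) : p.2 = F p.1 := by
  induction hp with
  | base p hp => exact hF p hp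
  | func f ps _ ih =>
    simp only [ih]
    exact (F.map_fun f _).symm

theorem isPartialIso_of_equiv {Z : List (M × M)} (F : M ≃[L] M) (hF : ∀ p ∈ Z, p.2 = F p.1) :
    IsPartialIso L Z := by
  refine ⟨fun p q hp hq => ?_, fun k r ps hps => ?_⟩
  · rw [hp.snd_eq hF, hq.snd_eq hF, F.injective.eq_iff]
  · simp only [fun i => (hps i).snd_eq hF]
    exact (F.map_rel r _).symm

theorem PairGen.fst_mem {Z : List (M × M)} {p : M × M} (hp : PairGen L Z p) :
    p.1 ∈ cl L (Z.map Prod.fst) := by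
  induction hp with
  | base p hp => exact Substructure.subset_closure (List.mem_map_of_mem hp)
  | func f ps _ ih => exact (cl L (Z.map Prod.fst)).fun_mem f _ ih

theorem exists_pairGen_of_mem {Z : List (M × M)} {x : M} (hx : x ∈ cl L (Z.map Prod.fst)) :
    ∃ y, PairGen L Z (x, y) := by
  refine Substructure.closure_induction (p := fun x => ∃ y, PairGen L Z (x, y)) hx ?_ ?_
  · intro x hx
    obtain ⟨p, hp, rfl⟩ := List.mem_map.1 hx
    exact ⟨p.2, .base p hp⟩
  · intro n f xs hxs
    choose ys hys using hxs
    exact ⟨_, PairGen.func f (fun i => (xs i, ys i)) hys⟩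

/-- The embedding of the substructure generated by the first coordinates. -/
theorem IsPartialIso.exists_embedding {Z : List (M × M)} (hZ : IsPartialIso L Z) :
    ∃ e : cl L (Z.map Prod.fst) ↪[L] M, ∀ x : cl L (Z.map Prod.fst),
      PairGen L Z (x, e x) := by
  choose e he using fun x : cl L (Z.map Prod.fst) => exists_pairGen_of_mem x.2
  refine ⟨⟨⟨e, fun x y hxy => ?_⟩, fun {n} f xs => ?_, fun {n} r xs => ?_⟩, he⟩
  · exact Subtype.ext ((hZ.eq_iff _ _ (he x) (he y)).2 hxy)
  · exact (hZ.eq_iff _ _ (he _) (PairGen.func f (fun i => (((xs i : M), e (xs i)) : M × M))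
      fun i => he (xs i))).1 rfl
  · exact (hZ.rel_iff _ r (fun i => (((xs i : M), e (xs i)) : M × M)) fun i => he (xs i)).symm

variable (L) in
/-- Every isomorphism from the substructure generated by `a` onto a substructure extends to an
automorphism. -/
def IsHomogeneousTuple (a : List M) : Prop :=
  ∀ Z : List (M × M), Z.map Prod.fst = a → IsPartialIso L Z →
    ∃ F : M ≃[L] M, ∀ p ∈ Z, p.2 = F p.1

/-- List the finitely many generators of the substructure that the hypothesis provides. A partial
isomorphism on them induces an embedding, which is an isomorphism onto its range. -/
theorem exists_isHomogeneousTuple (hU : CofinallyUltrahomogeneous L M) (a : List M) :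
    ∃ c : List M, (∀ x ∈ a, x ∈ cl L c) ∧ IsHomogeneousTuple L c := by
  obtain ⟨B, hB, haB, hext⟩ := hU {x | x ∈ a} a.finite_toSet
  obtain ⟨S, rfl⟩ := hB
  have hS : cl L S.toList = Substructure.closure L (S : Set M) := by
    simp only [cl, Finset.mem_toList, Finset.setOfPred_mem]
  rw [← hS] at hext haB
  refine ⟨S.toList, fun x hx => haB hx, fun Z hZ hiso => ?_⟩
  obtain ⟨e, he⟩ := hiso.exists_embedding
  rw [← hZ] at hext
  obtain ⟨F, hF⟩ := hext _ e.equivRange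
  refine ⟨F, fun p hp => ?_⟩
  have hp1 := (PairGen.base (L := L) p hp).fst_mem
  have h1 := he ⟨p.1, hp1⟩
  have h2 := hF ⟨p.1, hp1⟩
  rw [Embedding.equivRange_apply] at h2
  exact ((hiso.eq_iff p _ (.base p hp) h1).1 rfl).trans h2.symm

theorem exists_map_fst_eq_append {Z : List (M × M)} {a b : List M}
    (h : Z.map Prod.fst = a ++ b) : ∃ X Y : List (M × M), Z = X ++ Y ∧ X.map Prod.fst = a ∧
      Y.map Prod.fst = b := by
  obtain ⟨X, Y, rfl, h1, h2⟩ := List.map_eq_append_iff.1 h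
  exact ⟨X, Y, rfl, h1, h2⟩

/-- In a cofinally ultrahomogeneous structure, homogeneity of a tuple is a one-step extension
property. -/
theorem isHomogeneousTuple_iff (hU : CofinallyUltrahomogeneous L M) {a : List M} :
    IsHomogeneousTuple L a ↔ ∀ Z : List (M × M), Z.map Prod.fst = a → IsPartialIso L Z →
      ∀ c : List M, ∃ Y : List (M × M), Y.map Prod.fst = c ∧ IsPartialIso L (Z ++ Y) := by
  constructor
  · intro h Z hZ hiso c
    obtain ⟨F, hF⟩ := h Z hZ hiso
    refine ⟨c.map fun x => (x, F x), by simp [Function.comp_def], isPartialIso_of_equiv F ?_⟩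
    intro p hp
    rcases List.mem_append.1 hp with hp | hp
    · exact hF p hp
    · obtain ⟨x, -, rfl⟩ := List.mem_map.1 hp
      rfl
  · intro h Z hZ hiso
    -- Extend `Z` to a homogeneous `c` generating `a`. The new part `Y` is induced by an
    -- automorphism, and it determines the images of all elements of `cl L c`, hence those
    -- prescribed by `Z`.
    obtain ⟨c, hac, hc⟩ := exists_isHomogeneousTuple hU a
    obtain ⟨Y, rfl, hZY⟩ := h Z hZ hiso c
    obtain ⟨F, hF⟩ := hc Y rfl (hZY.mono (List.subset_append_right _ _))
    refine ⟨F, fun p hp => ?_⟩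
    obtain ⟨y, hy⟩ := exists_pairGen_of_mem (hac p.1 (hZ ▸ List.mem_map_of_mem hp))
    have hFy : y = F p.1 := hy.snd_eq hF
    rw [← hFy]
    exact (hZY.eq_iff p (p.1, y) (.base p (List.mem_append_left _ hp))
      (hy.mono fun q hq => .base q (List.mem_append_right _ hq))).1 rfl

/-- An automorphism extending the pairs over `b` is forced to agree with the pairs over `a`, which
lies in the substructure generated by `b`. -/
theorem isHomogeneousTuple_append {a b : List M} (hb : IsHomogeneousTuple L b)
    (h : ∀ x ∈ a, x ∈ cl L b) : IsHomogeneousTuple L (a ++ b) := by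
  intro Z hZ hiso
  obtain ⟨X, Y, rfl, rfl, rfl⟩ := exists_map_fst_eq_append hZ
  obtain ⟨F, hF⟩ := hb Y rfl (hiso.mono (List.subset_append_right _ _))
  refine ⟨F, fun p hp => ?_⟩
  rcases List.mem_append.1 hp with hp' | hp'
  · obtain ⟨y, hy⟩ := exists_pairGen_of_mem (h p.1 (List.mem_map_of_mem hp'))
    have hFy : y = F p.1 := hy.snd_eq hF
    rw [← hFy]
    exact (hiso.eq_iff p (p.1, y) (.base p hp)
      (hy.mono fun q hq => .base q (List.mem_append_right _ hq))).1 rfl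
  · exact hF p hp'

/-- Pull the first coordinates back along `F`, extend over `a` to an automorphism `G`, and use `G ∘
F⁻¹`. -/
theorem isHomogeneousTuple_of_equiv {a : List M} (ha : IsHomogeneousTuple L a) (F : M ≃[L] M) :
    IsHomogeneousTuple L (a.map F) := by
  intro Z hZ hiso
  have key : ∀ p, PairGen L (Z.map fun p => (F.symm p.1, p.2)) p → PairGen L Z (F p.1, p.2) := by
    intro p hp
    induction hp with
    | base p hp =>
      obtain ⟨q, hq, rfl⟩ := List.mem_map.1 hp
      simpa using PairGen.base (L := L) q hq
    | func f ps _ ih =>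
      have := PairGen.func f _ ih
      rwa [show (fun i => (F (ps i).1, (ps i).2).1) = F ∘ fun i => (ps i).1 from rfl,
        ← F.map_fun] at this
  obtain ⟨G, hG⟩ := ha (Z.map fun p => (F.symm p.1, p.2)) (by
      have : a = (Z.map Prod.fst).map F.symm := by simp [hZ, Function.comp_def]
      rw [this]
      simp [Function.comp_def]) ⟨fun p q hp hq => by
        rw [← hiso.eq_iff _ _ (key p hp) (key q hq)]
        exact F.injective.eq_iff.symm, fun k r ps hps => by
        rw [← hiso.rel_iff k r _ fun i => key _ (hps i)]
        exact (F.map_rel r _).symm⟩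
  refine ⟨G.comp F.symm, fun p hp => ?_⟩
  exact hG (F.symm p.1, p.2) (List.mem_map.2 ⟨p, hp, rfl⟩)

theorem isCofinalCollection_isHomogeneousTuple (hU : CofinallyUltrahomogeneous L M) :
    IsCofinalCollection L {a : List M | IsHomogeneousTuple L a} where
  cofinal a := by
    obtain ⟨c, h1, h2⟩ := exists_isHomogeneousTuple hU a
    exact ⟨c, h2, h1⟩
  append b hb a ha := isHomogeneousTuple_append hb ha
  clSim a ha b hab := by
    obtain ⟨Z, hZ, rfl, hiso⟩ := clSim_iff.1 hab
    -- Homogeneity of `a` makes any `≈`-equivalent tuple an automorphic image of `a`.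
    obtain ⟨F, hF⟩ := ha Z hZ hiso
    have : Z.map Prod.snd = a.map F := by
      rw [← hZ, List.map_map]
      exact List.map_congr_left hF
    rw [this]
    exact isHomogeneousTuple_of_equiv ha F

/-- One step of the back-and-forth construction. -/
theorem exists_extension_of_isPartialIso (hU : CofinallyUltrahomogeneous L M) {Z : List (M × M)}
    (hZ : IsPartialIso L Z) (hh : IsHomogeneousTuple L (Z.map Prod.fst)) (x : M) :
    ∃ Y, Z <+: Y ∧ IsPartialIso L Y ∧ IsHomogeneousTuple L (Y.map Prod.fst) ∧
      x ∈ Y.map Prod.fst ∧ x ∈ Y.map Prod.snd := by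
  obtain ⟨F, hF⟩ := hh Z rfl hZ
  -- Adding `x` and its preimage performs forth and back at once; adding `c` restores homogeneity of
  -- the domain.
  obtain ⟨c, hc, hch⟩ := exists_isHomogeneousTuple hU (Z.map Prod.fst ++ [x, F.symm x])
  let l : List M := [x, F.symm x] ++ c
  refine ⟨Z ++ l.map fun y => (y, F y), List.prefix_append _ _,
    isPartialIso_of_equiv F ?_, ?_, ?_, ?_⟩
  · intro p hp
    rcases List.mem_append.1 hp with hp | hp
    · exact hF p hp
    · obtain ⟨y, -, rfl⟩ := List.mem_map.1 hp
      rfl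
  · have : (Z ++ l.map fun y => (y, F y)).map Prod.fst =
        (Z.map Prod.fst ++ [x, F.symm x]) ++ c := by
      simp [l, Function.comp_def]
    rw [this]
    exact isHomogeneousTuple_append hch hc
  · simp [l]
  · simp [l]

/-- Without duplicates the two coordinates of `Z` are injective `n`-tuples, and the full permutation
group is `n`-transitive. -/
theorem IsPartialInj.exists_perm {M : Type*} {Z : List (M × M)} (hZ : IsPartialInj Z) :
    ∃ F : Equiv.Perm M, ∀ p ∈ Z, p.2 = F p.1 := by
  classical
  let n := Z.dedup.length
  have hmem : ∀ i : Fin n, Z.dedup.get i ∈ Z := fun i => List.mem_dedup.1 (List.get_mem _ _)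
  have hnd : Function.Injective Z.dedup.get := List.nodup_iff_injective_get.1 Z.nodup_dedup
  have hst := Equiv.Perm.isMultiplyPretransitive M n
  obtain ⟨F, hF⟩ := hst.exists_smul_eq
    (⟨fun i => (Z.dedup.get i).1, fun i j h => hnd (Prod.ext h
      ((hZ _ (hmem i) _ (hmem j)).1 h))⟩ : Fin n ↪ M)
    ⟨fun i => (Z.dedup.get i).2, fun i j h => hnd (Prod.ext
      ((hZ _ (hmem i) _ (hmem j)).2 h) h)⟩
  refine ⟨F, fun p hp => ?_⟩
  obtain ⟨i, rfl⟩ := List.mem_iff_get.1 (List.mem_dedup.2 hp)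
  exact (DFunLike.congr_fun hF i).symm

theorem exists_extension_of_isPartialInj {M : Type*} {Z : List (M × M)} (hZ : IsPartialInj Z)
    (x : M) : ∃ Y, Z <+: Y ∧ IsPartialInj Y ∧ x ∈ Y.map Prod.fst ∧ x ∈ Y.map Prod.snd := by
  obtain ⟨F, hF⟩ := hZ.exists_perm
  have h : ∀ p ∈ Z ++ [(x, F x), (F.symm x, x)], p.2 = F p.1 := by
    simp only [List.mem_append, List.mem_cons, List.not_mem_nil, or_false]
    rintro p (hp | rfl | rfl)
    · exact hF p hp
    · rfl
    · simp
  refine ⟨Z ++ [(x, F x), (F.symm x, x)], List.prefix_append _ _, fun p hp q hq => ?_, ?_, ?_⟩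
  · rw [h p hp, h q hq, F.injective.eq_iff]
  · simp
  · simp

/-- The bijection given by an exhausting chain of finite partial injections. -/
theorem exists_equiv_of_chain {M : Type*} {Z : ℕ → List (M × M)}
    (hc : ∀ n, Z n <+: Z (n + 1)) (hi : ∀ n, IsPartialInj (Z n))
    (h1 : ∀ x, ∃ n, x ∈ (Z n).map Prod.fst) (h2 : ∀ x, ∃ n, x ∈ (Z n).map Prod.snd) :
    ∃ σ : M ≃ M, ∀ n, ∀ p ∈ Z n, p.2 = σ p.1 := by
  have hmono : ∀ {m n}, m ≤ n → Z m ⊆ Z n := fun {m n} hmn => by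
    induction hmn with
    | refl => exact List.Subset.refl _
    | step _ ih => exact List.Subset.trans ih (hc _).subset
  have hinj : ∀ {m n p q}, p ∈ Z m → q ∈ Z n → (p.1 = q.1 ↔ p.2 = q.2) :=
    fun {m n p q} hp hq => hi (max m n) p (hmono (le_max_left _ _) hp) q
      (hmono (le_max_right _ _) hq)
  have h1' : ∀ x, ∃ y, ∃ n, (x, y) ∈ Z n := fun x => by
    obtain ⟨n, hn⟩ := h1 x
    obtain ⟨p, hp, rfl⟩ := List.mem_map.1 hn
    exact ⟨p.2, n, hp⟩
  choose f hf using h1'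
  have hf' : ∀ n, ∀ p ∈ Z n, p.2 = f p.1 := fun n p hp => by
    obtain ⟨m, hm⟩ := hf p.1
    exact (hinj hp hm).1 rfl
  refine ⟨Equiv.ofBijective f ⟨fun x y hxy => ?_, fun y => ?_⟩, hf'⟩
  · obtain ⟨m, hm⟩ := hf x
    obtain ⟨n, hn⟩ := hf y
    exact (hinj hm hn).2 hxy
  · obtain ⟨n, hn⟩ := h2 y
    obtain ⟨p, hp, rfl⟩ := List.mem_map.1 hn
    exact ⟨p.1, (hf' n p hp).symm⟩

/-- Any single instance of a function or relation involves finitely many elements, all of which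
occur in one stage of the chain. -/
theorem exists_automorphism_of_chain {Z : ℕ → List (M × M)} (hc : ∀ n, Z n <+: Z (n + 1))
    (hi : ∀ n, IsPartialIso L (Z n)) (h1 : ∀ x, ∃ n, x ∈ (Z n).map Prod.fst) (σ : M ≃ M)
    (hσ : ∀ n, ∀ p ∈ Z n, p.2 = σ p.1) : ∃ F : M ≃[L] M, ∀ x, F x = σ x := by
  have hmono : ∀ {m n}, m ≤ n → Z m ⊆ Z n := fun {m n} hmn => by
    induction hmn with
    | refl => exact List.Subset.refl _
    | step _ ih => exact List.Subset.trans ih (hc _).subset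
  have hmem : ∀ x, ∃ n, ∀ m, n ≤ m → (x, σ x) ∈ Z m := fun x => by
    obtain ⟨n, hn⟩ := h1 x
    obtain ⟨p, hp, rfl⟩ := List.mem_map.1 hn
    refine ⟨n, fun m hm => hmono hm ?_⟩
    rwa [← hσ n p hp]
  choose N hN using hmem
  refine ⟨⟨σ, fun {k} f xs => ?_, fun {k} r xs => ?_⟩, fun x => rfl⟩
  · let m := max (N (funMap f xs)) (Finset.univ.sup fun i => N (xs i))
    have hxs : ∀ i, PairGen L (Z m) (xs i, σ (xs i)) := fun i => .base _
      (hN _ _ ((Finset.le_sup (f := fun i => N (xs i)) (Finset.mem_univ i)).trans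
        (le_max_right _ _)))
    exact ((hi m).eq_iff _ _ (.base _ (hN _ m (le_max_left _ _)))
      (PairGen.func f _ hxs)).1 rfl
  · let m := Finset.univ.sup fun i => N (xs i)
    have hxs : ∀ i, PairGen L (Z m) (xs i, σ (xs i)) := fun i => .base _
      (hN _ _ (Finset.le_sup (f := fun i => N (xs i)) (Finset.mem_univ i)))
    exact ((hi m).rel_iff k r _ hxs).symm

end PartialIsomorphisms

/-! ### Finite certificates of failure to be a partial isomorphism. -/

section Derivations

/-- A step of a derivation: two stages, a function symbol with a list of pairs of arguments, and
the pair of values. -/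
abbrev DerivationStep : Type := ((ℕ × ℕ) × (ℕ × List (ℕ × ℕ))) × (ℕ × ℕ)

/-- The pairs obtained from `Z` by a derivation. -/
def derivedPairs (Z : List (ℕ × ℕ)) (l : List DerivationStep) : List (ℕ × ℕ) := Z ++ l.map Prod.snd

/-- The step applies a function to pairs that are already derived; `qF` are the stages of the
enumeration of the graphs of the functions. -/
def IsStep (qF : ℕ × (ℕ × List ℕ × ℕ) → Prop) (Z : List (ℕ × ℕ)) (l : List DerivationStep)
    (e : DerivationStep) : Prop :=
  (qF (e.1.1.1, e.1.2.1, e.1.2.2.map Prod.fst, e.2.1) ∧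
    qF (e.1.1.2, e.1.2.1, e.1.2.2.map Prod.snd, e.2.2)) ∧
  ∀ p ∈ e.1.2.2, p ∈ derivedPairs Z l

/-- Derivations, with the last step first. -/
def IsDerivation (qF : ℕ × (ℕ × List ℕ × ℕ) → Prop) (Z : List (ℕ × ℕ)) :
    List DerivationStep → Prop
  | [] => True
  | e :: l => IsStep qF Z l e ∧ IsDerivation qF Z l

/-- Two derived pairs violate injectivity or functionality. -/
def IsEqMismatch (D : List (ℕ × ℕ)) (p : (ℕ × ℕ) × (ℕ × ℕ)) : Prop :=
  (p.1 ∈ D ∧ p.2 ∈ D) ∧ ¬ (p.1.1 = p.2.1 ↔ p.1.2 = p.2.2)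

/-- A relation holds at one and fails at the other of two derived tuples; `qP` and `qN` are the
stages of the enumerations of the positive and of the negative facts. -/
def IsRelMismatch (qP qN : ℕ × (ℕ × List ℕ) → Prop) (D : List (ℕ × ℕ))
    (w : (ℕ × ℕ) × (ℕ × List (ℕ × ℕ))) : Prop :=
  (∀ p ∈ w.2.2, p ∈ D) ∧
    ((qP (w.1.1, w.2.1, w.2.2.map Prod.fst) ∧ qN (w.1.2, w.2.1, w.2.2.map Prod.snd)) ∨
     (qN (w.1.1, w.2.1, w.2.2.map Prod.fst) ∧ qP (w.1.2, w.2.1, w.2.2.map Prod.snd)))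

/-- A mismatch witnesses that a list of pairs does not generate a partial isomorphism. -/
def IsMismatch (qF : ℕ × (ℕ × List ℕ × ℕ) → Prop) (qP qN : ℕ × (ℕ × List ℕ) → Prop)
    (w : List (ℕ × ℕ) × (List DerivationStep × ((ℕ × ℕ) × (ℕ × ℕ)) ×
      ((ℕ × ℕ) × (ℕ × List (ℕ × ℕ))))) : Prop :=
  IsDerivation qF w.1 w.2.1 ∧ (IsEqMismatch (derivedPairs w.1 w.2.1) w.2.2.1 ∨
    IsRelMismatch qP qN (derivedPairs w.1 w.2.1) w.2.2.2)

theorem primrecRel_mem {α : Type*} [Primcodable α] :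
    PrimrecRel fun (a : α) (l : List α) => a ∈ l :=
  ((PrimrecRel.exists_mem_list (R := fun a b : α => a = b) Primrec.eq).comp Primrec.snd
    Primrec.fst).of_eq fun _ => by simp

theorem primrecRel_subset {α : Type*} [Primcodable α] :
    PrimrecRel fun (l l' : List α) => ∀ a ∈ l, a ∈ l' :=
  PrimrecRel.forall_mem_list primrecRel_mem

theorem derivedPairs_primrec : Primrec₂ derivedPairs :=
  Primrec.list_append.comp Primrec.fst (Primrec.list_map Primrec.snd (Primrec.snd.comp Primrec.snd))

theorem isStep_primrec {qF : ℕ × (ℕ × List ℕ × ℕ) → Prop} (hF : PrimrecPred qF) :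
    PrimrecPred fun w : List (ℕ × ℕ) × List DerivationStep × DerivationStep =>
      IsStep qF w.1 w.2.1 w.2.2 := by
  have he : Primrec fun w : List (ℕ × ℕ) × List DerivationStep × DerivationStep => w.2.2 :=
    Primrec.snd.comp Primrec.snd
  have h1 := Primrec.fst.comp he
  have hk := Primrec.fst.comp h1
  have hf := Primrec.fst.comp (Primrec.snd.comp h1)
  have hps := Primrec.snd.comp (Primrec.snd.comp h1)
  have h2 := Primrec.snd.comp he
  refine ((hF.comp ?_).and (hF.comp ?_)).and (primrecRel_subset.comp hps
    (derivedPairs_primrec.comp Primrec.fst (Primrec.fst.comp Primrec.snd)))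
  · exact (Primrec.fst.comp hk).pair (hf.pair
      ((Primrec.list_map hps (Primrec.fst.comp Primrec.snd).to₂).pair (Primrec.fst.comp h2)))
  · exact (Primrec.snd.comp hk).pair (hf.pair
      ((Primrec.list_map hps (Primrec.snd.comp Primrec.snd).to₂).pair (Primrec.snd.comp h2)))

theorem isDerivation_primrec {qF : ℕ × (ℕ × List ℕ × ℕ) → Prop} (hF : PrimrecPred qF) :
    PrimrecPred fun w : List (ℕ × ℕ) × List DerivationStep => IsDerivation qF w.1 w.2 := by
  classical
  have hs := (isStep_primrec hF).decide
  have h : Primrec fun w : List (ℕ × ℕ) × List DerivationStep =>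
      (List.rec true (fun e l IH => decide (IsStep qF w.1 l e) && IH) w.2 : Bool) :=
    Primrec.list_rec (h := fun w p => decide (IsStep qF w.1 p.2.1 p.1) && p.2.2)
      Primrec.snd (Primrec.const true) (Primrec.and.comp
        (hs.comp (Primrec.pair (Primrec.fst.comp Primrec.fst) (Primrec.pair
          (Primrec.fst.comp (Primrec.snd.comp Primrec.snd)) (Primrec.fst.comp Primrec.snd))))
        (Primrec.snd.comp (Primrec.snd.comp Primrec.snd)))
  refine (Primrec.eq.comp h (Primrec.const true)).of_eq ?_
  rintro ⟨Z, l⟩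
  induction l with
  | nil => simp [IsDerivation]
  | cons e l ih => simp [IsDerivation, ← ih]

theorem isEqMismatch_primrec : PrimrecRel IsEqMismatch := by
  have h1 : Primrec fun w : List (ℕ × ℕ) × ((ℕ × ℕ) × (ℕ × ℕ)) => w.2.1 :=
    Primrec.fst.comp Primrec.snd
  have h2 : Primrec fun w : List (ℕ × ℕ) × ((ℕ × ℕ) × (ℕ × ℕ)) => w.2.2 :=
    Primrec.snd.comp Primrec.snd
  have ha : PrimrecPred fun w : List (ℕ × ℕ) × ((ℕ × ℕ) × (ℕ × ℕ)) => w.2.1.1 = w.2.2.1 :=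
    Primrec.eq.comp (Primrec.fst.comp h1) (Primrec.fst.comp h2)
  have hb : PrimrecPred fun w : List (ℕ × ℕ) × ((ℕ × ℕ) × (ℕ × ℕ)) => w.2.1.2 = w.2.2.2 :=
    Primrec.eq.comp (Primrec.snd.comp h1) (Primrec.snd.comp h2)
  refine (((primrecRel_mem.comp h1 Primrec.fst).and (primrecRel_mem.comp h2 Primrec.fst)).and
    ((ha.and hb.not).or (hb.and ha.not))).of_eq fun w => ?_
  unfold IsEqMismatch
  tauto

theorem isRelMismatch_primrec {qP qN : ℕ × (ℕ × List ℕ) → Prop} (hP : PrimrecPred qP)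
    (hN : PrimrecPred qN) : PrimrecRel (IsRelMismatch qP qN) := by
  have hw : Primrec fun w : List (ℕ × ℕ) × ((ℕ × ℕ) × (ℕ × List (ℕ × ℕ))) => w.2 := Primrec.snd
  have hk := Primrec.fst.comp hw
  have hr := Primrec.fst.comp (Primrec.snd.comp hw)
  have hps := Primrec.snd.comp (Primrec.snd.comp hw)
  have h1 := (Primrec.fst.comp hk).pair (hr.pair
    (Primrec.list_map hps (Primrec.fst.comp Primrec.snd).to₂))
  have h2 := (Primrec.snd.comp hk).pair (hr.pair
    (Primrec.list_map hps (Primrec.snd.comp Primrec.snd).to₂))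
  exact (primrecRel_subset.comp hps Primrec.fst).and
    (((hP.comp h1).and (hN.comp h2)).or ((hN.comp h1).and (hP.comp h2)))

theorem isMismatch_primrec {qF : ℕ × (ℕ × List ℕ × ℕ) → Prop} {qP qN : ℕ × (ℕ × List ℕ) → Prop}
    (hF : PrimrecPred qF) (hP : PrimrecPred qP) (hN : PrimrecPred qN) :
    PrimrecPred (IsMismatch qF qP qN) := by
  have hl := Primrec.fst.comp (Primrec.snd (α := List (ℕ × ℕ)) (β := List DerivationStep ×
    ((ℕ × ℕ) × (ℕ × ℕ)) × ((ℕ × ℕ) × (ℕ × List (ℕ × ℕ)))))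
  have hD := derivedPairs_primrec.comp Primrec.fst hl
  exact ((isDerivation_primrec hF).comp (Primrec.fst.pair hl)).and
    ((isEqMismatch_primrec.comp hD (Primrec.fst.comp (Primrec.snd.comp Primrec.snd))).or
      ((isRelMismatch_primrec hP hN).comp hD (Primrec.snd.comp (Primrec.snd.comp Primrec.snd))))

/-- A step only requires its arguments to be derived already, so it stays valid when more pairs are
available. This lets derivations of several pairs be merged. -/
theorem IsDerivation.append {qF : ℕ × (ℕ × List ℕ × ℕ) → Prop} {Z : List (ℕ × ℕ)}
    {l l' : List DerivationStep} (h : IsDerivation qF Z l) (h' : IsDerivation qF Z l') :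
    IsDerivation qF Z (l ++ l') := by
  induction l with
  | nil => exact h'
  | cons e l ih =>
    refine ⟨⟨h.1.1, fun p hp => ?_⟩, ih h.2⟩
    have := h.1.2 p hp
    rw [List.append_eq, derivedPairs, List.map_append, ← List.append_assoc]
    exact List.mem_append_left _ this

theorem IsDerivation.flatten {qF : ℕ × (ℕ × List ℕ × ℕ) → Prop} {Z : List (ℕ × ℕ)}
    {ls : List (List DerivationStep)} (h : ∀ l ∈ ls, IsDerivation qF Z l) :
    IsDerivation qF Z ls.flatten := by
  induction ls with
  | nil => trivial
  | cons l ls ih =>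
    exact (h l (by simp)).append (ih fun l' hl' => h l' (by simp [hl']))

theorem exists_common_derivation {qF : ℕ × (ℕ × List ℕ × ℕ) → Prop} {Z : List (ℕ × ℕ)} {k : ℕ}
    {ps : Fin k → ℕ × ℕ}
    (h : ∀ i, ∃ l, IsDerivation qF Z l ∧ ps i ∈ derivedPairs Z l) :
    ∃ l, IsDerivation qF Z l ∧ ∀ i, ps i ∈ derivedPairs Z l := by
  choose l hl hp using h
  refine ⟨(List.ofFn l).flatten, IsDerivation.flatten fun l' hl' => ?_, fun i => ?_⟩
  · obtain ⟨i, rfl⟩ := List.mem_ofFn.1 hl'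
    exact hl i
  · rcases List.mem_append.1 (hp i) with h | h
    · exact List.mem_append_left _ h
    · refine List.mem_append_right _ ?_
      obtain ⟨e, he, h⟩ := List.mem_map.1 h
      exact List.mem_map.2 ⟨e, List.mem_flatten.2 ⟨l i, List.mem_ofFn.2 ⟨i, rfl⟩, he⟩, h⟩

end Derivations

/-! ### Soundness and completeness of the certificates. -/

section Coding

open FirstOrder.Language FirstOrder.Language.Structure

/-- The pair of numbers underlying a pair of elements of a set of numbers. -/
def toNatPair {M : Set ℕ} (p : M × M) : ℕ × ℕ := (p.1, p.2)

theorem toNatPair_injective {M : Set ℕ} : Function.Injective (toNatPair (M := M)) :=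
  fun _ _ h => Prod.ext (Subtype.ext (congrArg Prod.fst h)) (Subtype.ext (congrArg Prod.snd h))

theorem toNatList_eq_map {M : Set ℕ} (a : List M) : toNatList a = a.map Subtype.val := by
  induction a with
  | nil => rfl
  | cons x a ih =>
    rw [List.map_cons, ← ih]
    rfl

theorem toNatList_injective {M : Set ℕ} : Function.Injective (toNatList (M := M)) := by
  intro a b h
  rw [toNatList_eq_map, toNatList_eq_map] at h
  exact List.map_injective_iff.2 Subtype.val_injective h

/-- A certificate stores bare lists of numbers; this recovers tuples of elements of `M` of the
correct arity from the two diagram facts. -/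
theorem eq_ofFn_toNatPair {M : Set ℕ} {k : ℕ} {ps : List (ℕ × ℕ)} {a b : Fin k → M}
    (ha : ps.map Prod.fst = toNatList (List.ofFn a))
    (hb : ps.map Prod.snd = toNatList (List.ofFn b)) :
    ps = List.ofFn fun i => toNatPair (a i, b i) := by
  have hlen : ps.length = k := by simpa [toNatList_eq_map] using congrArg List.length ha
  subst hlen
  refine List.ext_getElem (by simp) fun i h1 h2 => ?_
  have h3 := List.getElem_of_eq ha (i := i) (by simpa using h1)
  have h4 := List.getElem_of_eq hb (i := i) (by simpa using h1)
  simp only [toNatList_eq_map, List.getElem_map, List.getElem_ofFn] at h3 h4 ⊢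
  exact Prod.ext h3 h4

theorem map_fst_ofFn_toNatPair {M : Set ℕ} {k : ℕ} (ps : Fin k → M × M) :
    (List.ofFn fun i => toNatPair (ps i)).map Prod.fst =
      toNatList (List.ofFn fun i => (ps i).1) := by
  simp only [toNatList_eq_map, List.map_ofFn]
  rfl

theorem map_snd_ofFn_toNatPair {M : Set ℕ} {k : ℕ} (ps : Fin k → M × M) :
    (List.ofFn fun i => toNatPair (ps i)).map Prod.snd =
      toNatList (List.ofFn fun i => (ps i).2) := by
  simp only [toNatList_eq_map, List.map_ofFn]
  rfl

variable {L : FirstOrder.Language.{u, v}} {ρ : LanguageRep L} {M : Set ℕ} [L.Structure M]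

theorem exists_pairGen_of_derivation {qF : ℕ × (ℕ × List ℕ × ℕ) → Prop}
    (hF : ∀ a k, qF (k, a) → a ∈ funDiagram ρ M) {Z : List (M × M)} {l : List DerivationStep}
    (hl : IsDerivation qF (Z.map toNatPair) l) :
    ∀ p ∈ derivedPairs (Z.map toNatPair) l, ∃ q : M × M, PairGen L Z q ∧ toNatPair q = p := by
  induction l with
  | nil =>
    intro p hp
    simp only [derivedPairs, List.map_nil, List.append_nil] at hp
    obtain ⟨q, hq, rfl⟩ := List.mem_map.1 hp
    exact ⟨q, .base q hq, rfl⟩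
  | cons e l ih =>
    obtain ⟨⟨⟨h1, h2⟩, h3⟩, h4⟩ := hl
    have ih := ih h4
    intro p hp
    have hp' : p = e.2 ∨ p ∈ derivedPairs (Z.map toNatPair) l := by
      simp only [derivedPairs, List.map_cons, List.mem_append, List.mem_cons] at hp ⊢
      tauto
    rcases hp' with rfl | hp'
    · obtain ⟨f, a, ha⟩ := hF _ _ h1
      obtain ⟨f', b, hb⟩ := hF _ _ h2
      simp only [Prod.mk.injEq] at ha hb
      -- Both facts carry the same symbol number, so the same function is applied in both
      -- coordinates.
      obtain rfl : f = f' := Subtype.ext (ha.1.symm.trans hb.1)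
      have hps := eq_ofFn_toNatPair ha.2.1 hb.2.1
      refine ⟨_, PairGen.func (ρ.func f).2 (fun i => (a i, b i)) fun i => ?_,
        Prod.ext ha.2.2.symm hb.2.2.symm⟩
      obtain ⟨q, hq, h⟩ := ih (toNatPair (a i, b i)) (h3 _ (by
        rw [hps]
        exact List.mem_ofFn.2 ⟨i, rfl⟩))
      rwa [← toNatPair_injective h]
    · exact ih p hp'

theorem exists_derivation_of_pairGen {qF : ℕ × (ℕ × List ℕ × ℕ) → Prop}
    (hF : ∀ a, a ∈ funDiagram ρ M → ∃ k, qF (k, a)) {Z : List (M × M)} {p : M × M}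
    (hp : PairGen L Z p) : ∃ l, IsDerivation qF (Z.map toNatPair) l ∧
      toNatPair p ∈ derivedPairs (Z.map toNatPair) l := by
  induction hp with
  | base p hp =>
    exact ⟨[], trivial, List.mem_append_left _ (List.mem_map_of_mem hp)⟩
  | @func k f ps _ ih =>
    obtain ⟨l, hl, hps⟩ := exists_common_derivation ih
    obtain ⟨n, hn⟩ := ρ.func.surjective ⟨k, f⟩
    have hdiag : ∀ a : Fin k → M,
        ((n : ℕ), toNatList (List.ofFn a), ((funMap f a : M) : ℕ)) ∈ funDiagram ρ M := by
      -- Generalising the pair of arity and symbol allows `hn` to be substituted without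
      -- transporting tuples along an equality of arities.
      have : ∀ x : (Σ k, L.Functions k), ρ.func n = x → ∀ a : Fin x.1 → M,
          ((n : ℕ), toNatList (List.ofFn a), ((funMap x.2 a : M) : ℕ)) ∈ funDiagram ρ M := by
        rintro _ rfl a
        exact ⟨n, a, rfl⟩
      exact this _ hn
    obtain ⟨i, hi⟩ := hF _ (hdiag fun i => (ps i).1)
    obtain ⟨j, hj⟩ := hF _ (hdiag fun i => (ps i).2)
    refine ⟨(((i, j), ((n : ℕ), List.ofFn fun i => toNatPair (ps i))),
      toNatPair (funMap f fun i => (ps i).1, funMap f fun i => (ps i).2)) :: l,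
      ⟨⟨⟨?_, ?_⟩, fun p hp => ?_⟩, hl⟩, ?_⟩
    · rw [← map_fst_ofFn_toNatPair] at hi
      exact hi
    · rw [← map_snd_ofFn_toNatPair] at hj
      exact hj
    · obtain ⟨i, rfl⟩ := List.mem_ofFn.1 hp
      exact hps i
    · simp [derivedPairs]

/-- Derived pairs are exactly the generated ones. Having both the positive and the negative facts
enumerated makes every disagreement about a relation visible at finite stages. -/
theorem isPartialIso_iff_not_isMismatch {qF : ℕ × (ℕ × List ℕ × ℕ) → Prop}
    {qP qN : ℕ × (ℕ × List ℕ) → Prop} (hF : ∀ a, a ∈ funDiagram ρ M ↔ ∃ k, qF (k, a))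
    (hP : ∀ a, a ∈ posDiagram ρ M ↔ ∃ k, qP (k, a))
    (hN : ∀ a, a ∈ negDiagram ρ M ↔ ∃ k, qN (k, a)) {Z : List (M × M)} :
    IsPartialIso L Z ↔ ¬ ∃ w, IsMismatch qF qP qN (Z.map toNatPair, w) := by
  have hsound := fun {l} => exists_pairGen_of_derivation (qF := qF)
    (fun a k h => (hF a).2 ⟨k, h⟩) (Z := Z) (l := l)
  have hcomp := fun {p} => exists_derivation_of_pairGen (qF := qF)
    (fun a h => (hF a).1 h) (Z := Z) (p := p)
  constructor
  · rintro hZ ⟨⟨l, ⟨p, q⟩, ⟨i, j⟩, r, ps⟩, hl, h⟩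
    simp only at hl h
    rcases h with ⟨⟨hp, hq⟩, h⟩ | ⟨hps, h⟩
    · obtain ⟨p, hp2, rfl⟩ := hsound hl _ hp
      obtain ⟨q, hq2, rfl⟩ := hsound hl _ hq
      have := hZ.eq_iff p q hp2 hq2
      simp only [Subtype.ext_iff] at this
      exact h this
    · have key : ∀ (r r' : ρ.relDom) (a : Fin (ρ.rel r).1 → M) (b : Fin (ρ.rel r').1 → M),
          (r : ℕ) = r' → ps.map Prod.fst = toNatList (List.ofFn a) →
          ps.map Prod.snd = toNatList (List.ofFn b) →
          (RelMap (ρ.rel r).2 a ↔ RelMap (ρ.rel r').2 b) := by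
        intro r r' a b hr ha hb
        obtain rfl : r = r' := Subtype.ext hr
        refine hZ.rel_iff _ (ρ.rel r).2 (fun i => (a i, b i)) fun i => ?_
        obtain ⟨q, hq, h⟩ := hsound hl (toNatPair (a i, b i)) (hps _ (by
          rw [eq_ofFn_toNatPair ha hb]
          exact List.mem_ofFn.2 ⟨i, rfl⟩))
        rwa [← toNatPair_injective h]
      rcases h with ⟨h1, h2⟩ | ⟨h1, h2⟩
      · obtain ⟨r1, a, hra, ha⟩ := (hP _).2 ⟨_, h1⟩
        obtain ⟨r2, b, hrb, hb⟩ := (hN _).2 ⟨_, h2⟩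
        simp only [Prod.mk.injEq] at ha hb
        exact hrb ((key r1 r2 a b (ha.1.symm.trans hb.1) ha.2 hb.2).1 hra)
      · obtain ⟨r1, a, hra, ha⟩ := (hN _).2 ⟨_, h1⟩
        obtain ⟨r2, b, hrb, hb⟩ := (hP _).2 ⟨_, h2⟩
        simp only [Prod.mk.injEq] at ha hb
        exact hra ((key r1 r2 a b (ha.1.symm.trans hb.1) ha.2 hb.2).2 hrb)
  · intro h
    refine ⟨fun p q hp hq => ?_, fun k r ps hps => ?_⟩
    · by_contra hne
      obtain ⟨l, hl, hp⟩ := hcomp hp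
      obtain ⟨l', hl', hq⟩ := hcomp hq
      -- A certificate has slots for both kinds of conflict; `default` fills the one not in use.
      refine h ⟨(l ++ l', (toNatPair p, toNatPair q), default), hl.append hl',
        .inl ⟨⟨?_, ?_⟩, ?_⟩⟩
      · simp only [derivedPairs, List.map_append, List.mem_append] at hp ⊢
        tauto
      · simp only [derivedPairs, List.map_append, List.mem_append] at hq ⊢
        tauto
      · simpa only [toNatPair, Subtype.ext_iff] using hne
    · by_contra hne
      obtain ⟨l, hl, hps⟩ := exists_common_derivation fun i => hcomp (hps i)
      obtain ⟨n, hn⟩ := ρ.rel.surjective ⟨k, r⟩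
      have hpos : ∀ a : Fin k → M, RelMap r a →
          ((n : ℕ), toNatList (List.ofFn a)) ∈ posDiagram ρ M := by
        have : ∀ x : (Σ k, L.Relations k), ρ.rel n = x → ∀ a : Fin x.1 → M, RelMap x.2 a →
            ((n : ℕ), toNatList (List.ofFn a)) ∈ posDiagram ρ M := by
          rintro _ rfl a ha
          exact ⟨n, a, ha, rfl⟩
        exact this _ hn
      have hneg : ∀ a : Fin k → M, ¬ RelMap r a →
          ((n : ℕ), toNatList (List.ofFn a)) ∈ negDiagram ρ M := by
        have : ∀ x : (Σ k, L.Relations k), ρ.rel n = x → ∀ a : Fin x.1 → M, ¬ RelMap x.2 a →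
            ((n : ℕ), toNatList (List.ofFn a)) ∈ negDiagram ρ M := by
          rintro _ rfl a ha
          exact ⟨n, a, ha, rfl⟩
        exact this _ hn
      have hsub : ∀ p ∈ List.ofFn fun i => toNatPair (ps i),
          p ∈ derivedPairs (Z.map toNatPair) l := by
        intro p hp
        obtain ⟨i, rfl⟩ := List.mem_ofFn.1 hp
        exact hps i
      by_cases h1 : RelMap r fun i => (ps i).1
      · have h2 : ¬ RelMap r fun i => (ps i).2 := by tauto
        obtain ⟨i, hi⟩ := (hP _).1 (hpos _ h1)
        obtain ⟨j, hj⟩ := (hN _).1 (hneg _ h2)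
        rw [← map_fst_ofFn_toNatPair] at hi
        rw [← map_snd_ofFn_toNatPair] at hj
        exact h ⟨(l, default, (i, j), (n : ℕ), _), hl, .inr ⟨hsub, .inl ⟨hi, hj⟩⟩⟩
      · have h2 : RelMap r fun i => (ps i).2 := by tauto
        obtain ⟨i, hi⟩ := (hN _).1 (hneg _ h1)
        obtain ⟨j, hj⟩ := (hP _).1 (hpos _ h2)
        rw [← map_fst_ofFn_toNatPair] at hi
        rw [← map_snd_ofFn_toNatPair] at hj
        exact h ⟨(l, default, (i, j), (n : ℕ), _), hl, .inr ⟨hsub, .inr ⟨hi, hj⟩⟩⟩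

end Coding

/-! ### Counting jumps for the coded predicates. -/

section Complexity

variable {L : FirstOrder.Language.{u, v}} {ρ : LanguageRep L} {M : Set ℕ} [L.Structure M]

/-- The predicate on coded lists of pairs induced by a predicate on lists of pairs. -/
def OnCodes {M : Set ℕ} (P : List (M × M) → Prop) (Z : List (ℕ × ℕ)) : Prop :=
  ∃ Z' : List (M × M), Z'.map toNatPair = Z ∧ P Z'

theorem onCodes_map {P : List (M × M) → Prop} {Z : List (M × M)} :
    OnCodes P (Z.map toNatPair) ↔ P Z :=
  ⟨fun ⟨_, h, hP⟩ => List.map_injective_iff.2 toNatPair_injective h ▸ hP, fun h => ⟨Z, rfl, h⟩⟩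

theorem exists_toNatPair_iff {Z : List (ℕ × ℕ)} :
    (∃ Z' : List (M × M), Z'.map toNatPair = Z) ↔ ∀ p ∈ Z, p.1 ∈ M ∧ p.2 ∈ M := by
  constructor
  · rintro ⟨Z, rfl⟩ p hp
    obtain ⟨q, -, rfl⟩ := List.mem_map.1 hp
    exact ⟨q.1.2, q.2.2⟩
  · intro h
    induction Z with
    | nil => exact ⟨[], rfl⟩
    | cons p Z ih =>
      obtain ⟨Z', rfl⟩ := ih fun q hq => h q (List.mem_cons_of_mem _ hq)
      obtain ⟨h1, h2⟩ := h p (by simp)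
      exact ⟨(⟨p.1, h1⟩, ⟨p.2, h2⟩) :: Z', rfl⟩

theorem exists_toNatList_iff {a : List ℕ} :
    (∃ a' : List M, toNatList a' = a) ↔ ∀ x ∈ a, x ∈ M := by
  simp only [toNatList_eq_map]
  constructor
  · rintro ⟨a, rfl⟩ x hx
    obtain ⟨y, -, rfl⟩ := List.mem_map.1 hx
    exact y.2
  · intro h
    lift a to List M using h
    exact ⟨a, rfl⟩

/-- The quantifier over entries of the list is treated as unbounded. The jump this costs is
harmless, since deciding partial isomorphisms is done with that oracle anyway. -/
theorem decIn_exists_toNatPair (hM : ComputablePred fun n => n ∈ M) :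
    DecIn (jump ∅) fun Z : List (ℕ × ℕ) => ∃ Z' : List (M × M), Z'.map toNatPair = Z := by
  have h1 : DecIn ∅ fun w : List (ℕ × ℕ) × (ℕ × ℕ) => w.2 ∈ w.1 ∧ ¬ (w.2.1 ∈ M ∧ w.2.2 ∈ M) :=
    (primrecRel_mem.comp Primrec.snd Primrec.fst).decIn.and
      ((hM.decIn.comp (Primrec.fst.comp Primrec.snd)).and
        (hM.decIn.comp (Primrec.snd.comp Primrec.snd))).not
  refine h1.exists.not.of_iff fun Z => ?_
  rw [exists_toNatPair_iff]
  simp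

theorem decIn_exists_toNatList (hM : ComputablePred fun n => n ∈ M) :
    DecIn (jump ∅) fun a : List ℕ => ∃ a' : List M, toNatList a' = a := by
  have h1 : DecIn ∅ fun w : List ℕ × ℕ => w.2 ∈ w.1 ∧ w.2 ∉ M :=
    (primrecRel_mem.comp Primrec.snd Primrec.fst).decIn.and
      (hM.decIn.comp Primrec.snd).not
  refine h1.exists.not.of_iff fun Z => ?_
  rw [exists_toNatList_iff]
  simp

theorem decIn_isPartialInj (hM : ComputablePred fun n => n ∈ M) :
    DecIn (jump ∅) (OnCodes (M := M) IsPartialInj) := by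
  have h2 : DecIn ∅ fun w : List (ℕ × ℕ) × ((ℕ × ℕ) × (ℕ × ℕ)) => IsEqMismatch w.1 w.2 :=
    isEqMismatch_primrec.decIn
  refine ((decIn_exists_toNatPair hM).and h2.exists.not).of_iff fun Z => ?_
  constructor
  · rintro ⟨Z, rfl, hZ⟩
    refine ⟨⟨Z, rfl⟩, ?_⟩
    rintro ⟨⟨p, q⟩, ⟨hp, hq⟩, h⟩
    obtain ⟨p, hp', rfl⟩ := List.mem_map.1 hp
    obtain ⟨q, hq', rfl⟩ := List.mem_map.1 hq
    have := hZ p hp' q hq'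
    simp only [Subtype.ext_iff] at this
    exact h this
  · rintro ⟨⟨Z, rfl⟩, hZ⟩
    refine onCodes_map.2 fun p hp q hq => ?_
    by_contra h
    refine hZ ⟨(toNatPair p, toNatPair q), ⟨List.mem_map_of_mem hp, List.mem_map_of_mem hq⟩, ?_⟩
    simpa only [toNatPair, Subtype.ext_iff] using h

theorem IsComputableStructure.decIn_isPartialIso (hM : IsComputableStructure ρ M) :
    DecIn (jump ∅) (OnCodes (M := M) (IsPartialIso L)) := by
  obtain ⟨qF, hqF, hF⟩ := hM.func.exists_stage
  obtain ⟨qP, hqP, hP⟩ := hM.pos.exists_stage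
  obtain ⟨qN, hqN, hN⟩ := hM.neg.exists_stage
  refine ((decIn_exists_toNatPair hM.dom).and
    (isMismatch_primrec hqF hqP hqN).decIn.exists.not).of_iff fun Z => ?_
  constructor
  · rintro ⟨Z, rfl, hZ⟩
    exact ⟨⟨Z, rfl⟩, (isPartialIso_iff_not_isMismatch hF hP hN).1 hZ⟩
  · rintro ⟨⟨Z, rfl⟩, hZ⟩
    exact onCodes_map.2 ((isPartialIso_iff_not_isMismatch hF hP hN).2 hZ)

theorem map_fst_toNatPair (Z : List (M × M)) :
    (Z.map toNatPair).map Prod.fst = toNatList (Z.map Prod.fst) := by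
  simp only [toNatList_eq_map, List.map_map]
  rfl

theorem map_snd_toNatPair (Z : List (M × M)) :
    (Z.map toNatPair).map Prod.snd = toNatList (Z.map Prod.snd) := by
  simp only [toNatList_eq_map, List.map_map]
  rfl

theorem list_map_fst_primrec : Primrec fun Z : List (ℕ × ℕ) => Z.map Prod.fst :=
  Primrec.list_map Primrec.id (Primrec.fst.comp Primrec.snd).to₂

theorem list_map_snd_primrec : Primrec fun Z : List (ℕ × ℕ) => Z.map Prod.snd :=
  Primrec.list_map Primrec.id (Primrec.snd.comp Primrec.snd).to₂

/-- By the one-step extension property, two alternating quantifiers over a matrix decidable in the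
first jump suffice. -/
theorem decIn_isHomogeneousTuple (hM : IsComputableStructure ρ M)
    (hU : CofinallyUltrahomogeneous L M) :
    DecIn (jump (jump (jump ∅))) fun a : List ℕ => a ∈ toNatList '' {a : List M |
      IsHomogeneousTuple L a} := by
  have hiso := hM.decIn_isPartialIso
  have h1 : DecIn (jump ∅) fun w : (List (ℕ × ℕ) × List ℕ) × List (ℕ × ℕ) =>
      w.2.map Prod.fst = w.1.2 ∧ OnCodes (M := M) (IsPartialIso L) (w.1.1 ++ w.2) :=
    (Primrec.eq.comp (list_map_fst_primrec.comp Primrec.snd)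
      (Primrec.snd.comp Primrec.fst)).decIn.and
      (hiso.comp (Primrec.list_append.comp (Primrec.fst.comp Primrec.fst) Primrec.snd))
  -- The second component is a counterexample to homogeneity: a partial isomorphism together with a
  -- tuple to which it does not extend.
  have h2 : DecIn (jump (jump ∅)) fun w : List ℕ × (List (ℕ × ℕ) × List ℕ) =>
      (w.2.1.map Prod.fst = w.1 ∧ OnCodes (M := M) (IsPartialIso L) w.2.1 ∧
        ∃ c' : List M, toNatList c' = w.2.2) ∧ ¬ ∃ Y : List (ℕ × ℕ), Y.map Prod.fst = w.2.2 ∧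
          OnCodes (M := M) (IsPartialIso L) (w.2.1 ++ Y) :=
    ((Primrec.eq.comp (list_map_fst_primrec.comp (Primrec.fst.comp Primrec.snd))
      Primrec.fst).decIn.and ((hiso.jump.comp (Primrec.fst.comp Primrec.snd)).and
        ((decIn_exists_toNatList hM.dom).jump.comp (Primrec.snd.comp Primrec.snd)))).and
      (h1.exists.comp Primrec.snd).not
  refine ((decIn_exists_toNatList hM.dom).jump.jump.and h2.exists.not).of_iff fun a => ?_
  constructor
  · rintro ⟨a, ha, rfl⟩
    refine ⟨⟨a, rfl⟩, ?_⟩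
    rintro ⟨⟨Z, c⟩, ⟨hZa, ⟨Z, rfl, hZ⟩, ⟨c, rfl⟩⟩, h⟩
    simp only [map_fst_toNatPair] at hZa
    obtain ⟨Y, rfl, hY⟩ := (isHomogeneousTuple_iff hU).1 ha Z (toNatList_injective hZa) hZ c
    refine h ⟨Y.map toNatPair, map_fst_toNatPair Y, ?_⟩
    simp only [← List.map_append]
    exact onCodes_map.2 hY
  · rintro ⟨⟨a, rfl⟩, h⟩
    refine ⟨a, (isHomogeneousTuple_iff hU).2 fun Z hZa hZ c => ?_, rfl⟩
    by_contra hne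
    refine h ⟨(Z.map toNatPair, toNatList c), ⟨?_, onCodes_map.2 hZ, c, rfl⟩, ?_⟩
    · rw [map_fst_toNatPair, hZa]
    · rintro ⟨Y, hYc, Z', hZ', hiso'⟩
      obtain ⟨X, Y', rfl, hX, rfl⟩ := List.map_eq_append_iff.1 hZ'
      obtain rfl := List.map_injective_iff.2 toNatPair_injective hX
      exact hne ⟨Y', toNatList_injective ((map_fst_toNatPair Y').symm.trans hYc), hiso'⟩

end Complexity

/-! ### Effective back-and-forth, uniformly in the starting position. -/

section BackAndForth

variable {s M : Set ℕ}

/-- Back-and-forth with an oracle: if `R P Z` is decidable and every `Z` with `R P Z` extends, so as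
to contain a given element, to some `Y` with `R P Y`, then the limit function is computable
uniformly in `P`. -/
theorem exists_backAndForth_index (hM : ComputablePred fun n => n ∈ M)
    {R : List (ℕ × ℕ) → List (ℕ × ℕ) → Prop}
    (hR : DecIn s fun w : List (ℕ × ℕ) × List (ℕ × ℕ) => R w.1 w.2) :
    ∃ h : List (ℕ × ℕ) → ℕ, Primrec h ∧ ∀ P, R P P →
      (∀ Z, R P Z → ∀ n ∈ M, ∃ Y, Z <+: Y ∧ R P Y ∧ n ∈ Y.map Prod.fst ∧ n ∈ Y.map Prod.snd) →
      ∃ Z : ℕ → List (ℕ × ℕ), Z 0 = P ∧ (∀ n, R P (Z n)) ∧ (∀ n, Z n <+: Z (n + 1)) ∧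
        (∀ n ∈ M, n ∈ (Z (n + 1)).map Prod.fst ∧ n ∈ (Z (n + 1)).map Prod.snd) ∧
        ∀ n, (n ∉ M → phi s (h P) n = Part.none) ∧
          (n ∈ M → ∃ m ∈ phi s (h P) n, (n, m) ∈ Z (n + 1)) := by
  -- The components are the start, the number treated, the current list and its candidate successor.
  -- Nothing has to be captured when the number lies outside `M`, so the search also succeeds there
  -- and the chain never stalls.
  have hstep : DecIn s fun w : (List (ℕ × ℕ) × ℕ × List (ℕ × ℕ)) × List (ℕ × ℕ) =>
      (w.1.2.2 = w.2.take w.1.2.2.length ∧ R w.1.1 w.2) ∧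
        (w.1.2.1 ∈ M → w.1.2.1 ∈ w.2.map Prod.fst ∧ w.1.2.1 ∈ w.2.map Prod.snd) := by
    have hn : Primrec fun w : (List (ℕ × ℕ) × ℕ × List (ℕ × ℕ)) × List (ℕ × ℕ) => w.1.2.1 :=
      Primrec.fst.comp (Primrec.snd.comp Primrec.fst)
    have hZ : Primrec fun w : (List (ℕ × ℕ) × ℕ × List (ℕ × ℕ)) × List (ℕ × ℕ) => w.1.2.2 :=
      Primrec.snd.comp (Primrec.snd.comp Primrec.fst)
    exact ((Primrec.eq.comp hZ (Primrec.list_take.comp (Primrec.list_length.comp hZ)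
      Primrec.snd)).decIn.and (hR.comp ((Primrec.fst.comp Primrec.fst).pair Primrec.snd))).and
      ((hM.decIn.comp hn).imp
        ((primrecRel_mem.comp hn (list_map_fst_primrec.comp Primrec.snd)).decIn.and
          (primrecRel_mem.comp hn (list_map_snd_primrec.comp Primrec.snd)).decIn))
  obtain ⟨next, hnext, hdom, hspec⟩ := hstep.exists_search
  let state : List (ℕ × ℕ) → ℕ → Part (List (ℕ × ℕ)) := fun P n =>
    Nat.rec (motive := fun _ => Part (List (ℕ × ℕ))) (Part.some P)
      (fun y IH => IH.bind fun Z => next (P, y, Z)) n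
  -- The number `n` is treated in passing from stage `n` to stage `n + 1`, where its value can be
  -- read off.
  have hstate : RecursiveIn {charOracle s} fun w : List (ℕ × ℕ) × ℕ => state w.1 (w.2 + 1) :=
    RecursiveIn.nat_rec (f := fun w : List (ℕ × ℕ) × ℕ => w.2 + 1)
      (g := fun w : List (ℕ × ℕ) × ℕ => Part.some w.1)
      (h := fun q : (List (ℕ × ℕ) × ℕ) × ℕ × List (ℕ × ℕ) => next (q.1.1, q.2))
      (Primrec.succ.comp Primrec.snd).computableIn Primrec.fst.computableIn
      (hnext.comp ((Primrec.fst.comp Primrec.fst).pair Primrec.snd).computableIn)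
  -- Requiring membership in `M` makes the final search diverge on every input outside `M`.
  have hsel : DecIn s fun w : ((List (ℕ × ℕ) × ℕ) × List (ℕ × ℕ)) × ℕ =>
      w.1.1.2 ∈ M ∧ (w.1.1.2, w.2) ∈ w.1.2 :=
    (hM.decIn.comp (Primrec.snd.comp (Primrec.fst.comp Primrec.fst))).and
      (primrecRel_mem.comp ((Primrec.snd.comp (Primrec.fst.comp Primrec.fst)).pair Primrec.snd)
        (Primrec.snd.comp Primrec.fst)).decIn
  obtain ⟨sel, hselr, hseld, hsels⟩ := hsel.exists_search
  obtain ⟨h, hh, hphi⟩ := exists_index (RecursiveIn.bind hstate hselr)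
  refine ⟨h, hh, fun P hP hext => ?_⟩
  have hexist : ∀ n, ∃ Z, Z ∈ state P n ∧ R P Z := by
    intro n
    induction n with
    | zero => exact ⟨P, Part.mem_some _, hP⟩
    | succ n ih =>
      obtain ⟨Z, hZ, hRZ⟩ := ih
      have : (next (P, n, Z)).Dom := by
        rw [hdom]
        by_cases hn : n ∈ M
        · obtain ⟨Y, h1, h2, h3⟩ := hext Z hRZ n hn
          exact ⟨Y, ⟨List.prefix_iff_eq_take.1 h1, h2⟩, fun _ => h3⟩
        · exact ⟨Z, ⟨by simp, hRZ⟩, fun h => absurd h hn⟩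
      have hmem := Part.get_mem this
      exact ⟨_, Part.mem_bind_iff.2 ⟨Z, hZ, hmem⟩, (hspec _ _ hmem).1.2⟩
  choose Z hZ hRZ using hexist
  have hsucc : ∀ n, Z (n + 1) ∈ next (P, n, Z n) := fun n => by
    obtain ⟨Z', hZ', h⟩ := Part.mem_bind_iff.1 (hZ (n + 1))
    rwa [Part.mem_unique (hZ n) hZ']
  refine ⟨Z, Part.mem_some_iff.1 (hZ 0), hRZ, fun n => List.prefix_iff_eq_take.2
    (hspec _ _ (hsucc n)).1.1, fun n hn => (hspec _ _ (hsucc n)).2 hn, fun n => ⟨fun hn => ?_,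
    fun hn => ?_⟩⟩
  · rw [hphi, Part.eq_none_iff]
    rintro m hm
    obtain ⟨Z', -, hm⟩ := Part.mem_bind_iff.1 hm
    exact hn (hsels _ _ hm).1
  · have hd : (sel ((P, n), Z (n + 1))).Dom := by
      rw [hseld]
      obtain ⟨p, hp, hpn⟩ := List.mem_map.1 ((hspec _ _ (hsucc n)).2 hn).1
      exact ⟨p.2, hn, by rw [← show p = (n, p.2) from Prod.ext hpn rfl]; exact hp⟩
    have hmem := Part.get_mem hd
    refine ⟨_, ?_, (hsels _ _ hmem).2⟩
    rw [hphi]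
    exact Part.mem_bind_iff.2 ⟨_, hZ (n + 1), hmem⟩

end BackAndForth

/-! ### Assembling the homogeneity witness. -/

section Main

variable {L : FirstOrder.Language.{u, v}} {ρ : LanguageRep L} {M : Set ℕ} [L.Structure M]

/-- The positions of the back-and-forth game started at `P`: partial isomorphisms with homogeneous
domain if `P` is a partial isomorphism, partial injections otherwise. -/
def IsPosition (L : FirstOrder.Language.{u, v}) (M : Set ℕ) [L.Structure M]
    (P Z : List (ℕ × ℕ)) : Prop :=
  OnCodes (M := M) IsPartialInj Z ∧ (OnCodes (M := M) (IsPartialIso L) P →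
    OnCodes (M := M) (IsPartialIso L) Z ∧
      Z.map Prod.fst ∈ toNatList '' {a : List M | IsHomogeneousTuple L a})

/-- The case distinction on `P` is itself decidable with the oracle, so both kinds of game are
played by one procedure. -/
theorem decIn_isPosition (hM : IsComputableStructure ρ M) (hU : CofinallyUltrahomogeneous L M) :
    DecIn (jump (jump (jump ∅))) fun w : List (ℕ × ℕ) × List (ℕ × ℕ) =>
      IsPosition L M w.1 w.2 := by
  have hiso := hM.decIn_isPartialIso.jump.jump
  exact ((decIn_isPartialInj hM.dom).jump.jump.comp Primrec.snd).and
    ((hiso.comp Primrec.fst).imp ((hiso.comp Primrec.snd).and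
      ((decIn_isHomogeneousTuple hM hU).comp (list_map_fst_primrec.comp Primrec.snd))))

theorem IsPosition.exists_extension (hU : CofinallyUltrahomogeneous L M) {P Z : List (ℕ × ℕ)}
    (h : IsPosition L M P Z) {n : ℕ} (hn : n ∈ M) :
    ∃ Y, Z <+: Y ∧ IsPosition L M P Y ∧ n ∈ Y.map Prod.fst ∧ n ∈ Y.map Prod.snd := by
  obtain ⟨⟨Z, rfl, hinj⟩, hP⟩ := h
  have hmem : ∀ l : List M, (⟨n, hn⟩ : M) ∈ l → n ∈ toNatList l := fun l hl => by
    rw [toNatList_eq_map]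
    exact List.mem_map_of_mem hl
  by_cases hiso : OnCodes (M := M) (IsPartialIso L) P
  · obtain ⟨hZ, hh⟩ := hP hiso
    rw [map_fst_toNatPair, toNatList_injective.mem_set_image] at hh
    obtain ⟨Y, hZY, hY, hYh, h1, h2⟩ :=
      exists_extension_of_isPartialIso hU (onCodes_map.1 hZ) hh ⟨n, hn⟩
    refine ⟨Y.map toNatPair, hZY.map _, ⟨onCodes_map.2 hY.isPartialInj, fun _ =>
      ⟨onCodes_map.2 hY, ?_⟩⟩, ?_, ?_⟩
    · rw [map_fst_toNatPair]
      exact ⟨_, hYh, rfl⟩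
    · rw [map_fst_toNatPair]
      exact hmem _ h1
    · rw [map_snd_toNatPair]
      exact hmem _ h2
  · obtain ⟨Y, hZY, hY, h1, h2⟩ := exists_extension_of_isPartialInj hinj ⟨n, hn⟩
    refine ⟨Y.map toNatPair, hZY.map _, ⟨onCodes_map.2 hY, fun h => absurd h hiso⟩, ?_, ?_⟩
    · rw [map_fst_toNatPair]
      exact hmem _ h1
    · rw [map_snd_toNatPair]
      exact hmem _ h2

/-- Computable cofinally ultrahomogeneous structures are computably cofinally ultrahomogeneous in
the third jump. -/
theorem computablyCofinallyUltrahomogeneous_jump (hM : IsComputableStructure ρ M)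
    (hU : CofinallyUltrahomogeneous L M) :
    ComputablyCofinallyUltrahomogeneous L (jump (jump (jump ∅))) M := by
  have hE := decIn_isHomogeneousTuple hM hU
  obtain ⟨h, hh, hspec⟩ := exists_backAndForth_index hM.dom (decIn_isPosition hM hU)
  -- Searching for the list of pairs with the given coordinates halts exactly on the prescribed
  -- domain: success means that the coordinates lie in `M` and have the same equality pattern.
  have hsearch : DecIn (jump (jump (jump ∅))) fun w : (List ℕ × List ℕ) × List (ℕ × ℕ) =>
      (w.2.map Prod.fst = w.1.1 ∧ w.2.map Prod.snd = w.1.2) ∧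
        w.1.1 ∈ toNatList '' {a : List M | IsHomogeneousTuple L a} ∧
          OnCodes (M := M) IsPartialInj w.2 :=
    ((Primrec.eq.comp (list_map_fst_primrec.comp Primrec.snd)
      (Primrec.fst.comp Primrec.fst)).and (Primrec.eq.comp
        (list_map_snd_primrec.comp Primrec.snd) (Primrec.snd.comp Primrec.fst))).decIn.and
      ((hE.comp (Primrec.fst.comp Primrec.fst)).and
        ((decIn_isPartialInj hM.dom).jump.jump.comp Primrec.snd))
  obtain ⟨G, hG, hGd, hGs⟩ := hsearch.exists_search
  refine ⟨{a | IsHomogeneousTuple L a}, isCofinalCollection_isHomogeneousTuple hU, hE,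
    fun p => (G p).map h, RecursiveIn.map (g := fun w : (List ℕ × List ℕ) × List (ℕ × ℕ) => h w.2)
      hG (hh.comp Primrec.snd).computableIn, fun p => ?_, ?_⟩
  · refine (hGd p).trans ?_
    constructor
    · rintro ⟨_, ⟨h1, h2⟩, ⟨a, ha, hap⟩, Z, rfl, hZ⟩
      rw [map_fst_toNatPair] at h1
      rw [map_snd_toNatPair] at h2
      obtain rfl := toNatList_injective (hap.trans h1.symm)
      exact ⟨_, ha, _, tupleSim_iff.2 ⟨Z, rfl, rfl, hZ⟩, Prod.ext h1.symm h2.symm⟩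
    · rintro ⟨a, ha, b, hab, rfl⟩
      obtain ⟨Z, rfl, rfl, hZ⟩ := tupleSim_iff.1 hab
      exact ⟨Z.map toNatPair, ⟨map_fst_toNatPair Z, map_snd_toNatPair Z⟩, ⟨_, ha, rfl⟩,
        onCodes_map.2 hZ⟩
  · intro a ha b hab e he
    obtain ⟨_, hZ, rfl⟩ := (Part.mem_map_iff _).1 he
    obtain ⟨⟨h1, h2⟩, -, Z, rfl, hinj⟩ := hGs _ _ hZ
    simp only [map_fst_toNatPair, map_snd_toNatPair] at h1 h2
    obtain rfl := toNatList_injective h1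
    obtain rfl := toNatList_injective h2
    -- The start is a legal position because `a` is homogeneous.
    have hpos : IsPosition L M (Z.map toNatPair) (Z.map toNatPair) :=
      ⟨onCodes_map.2 hinj, fun hiso => ⟨hiso, by
        rw [map_fst_toNatPair]
        exact ⟨_, ha, rfl⟩⟩⟩
    obtain ⟨Y, hY0, hYpos, hYc, hYM, hphi⟩ :=
      hspec _ hpos fun Z' hZ' n hn => hZ'.exists_extension hU hn
    choose W hWY hW using fun n => (hYpos n).1
    obtain rfl : (fun n => (W n).map toNatPair) = Y := funext hWY
    have hWc : ∀ n, W n <+: W (n + 1) := fun n => by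
      obtain ⟨X, hX⟩ := hYc n
      obtain ⟨A, B, hAB, hA, -⟩ := List.map_eq_append_iff.1 hX.symm
      rw [hAB, List.map_injective_iff.2 toNatPair_injective hA]
      exact List.prefix_append _ _
    have hmem : ∀ (x : M) (l : List M), (x : ℕ) ∈ toNatList l → x ∈ l := fun x l hx => by
      rw [toNatList_eq_map] at hx
      obtain ⟨y, hy, hxy⟩ := List.mem_map.1 hx
      rwa [← Subtype.ext hxy]
    have hW1 : ∀ x : M, ∃ n, x ∈ (W n).map Prod.fst := fun x => ⟨x + 1, hmem _ _ (by
      rw [← map_fst_toNatPair]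
      exact (hYM x x.2).1)⟩
    have hW2 : ∀ x : M, ∃ n, x ∈ (W n).map Prod.snd := fun x => ⟨x + 1, hmem _ _ (by
      rw [← map_snd_toNatPair]
      exact (hYM x x.2).2)⟩
    have hW0 : W 0 = Z := List.map_injective_iff.2 toNatPair_injective hY0
    obtain ⟨σ, hσ⟩ := exists_equiv_of_chain hWc hW hW1 hW2
    refine ⟨σ, fun n => ⟨fun hn => ?_, fun hn => ?_⟩, fun x => ?_, ?_, fun hcl => ?_⟩
    · by_contra hnM
      rw [(hphi n).1 hnM] at hn
      exact hn
    · obtain ⟨m, hm, -⟩ := (hphi n).2 hn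
      exact Part.dom_iff_mem.2 ⟨m, hm⟩
    · obtain ⟨m, hm, hmW⟩ := (hphi x).2 x.2
      obtain ⟨q, hq, hqx⟩ := List.mem_map.1 hmW
      obtain ⟨h1, h2⟩ := Prod.mk.inj hqx
      rwa [← Subtype.ext h1, ← hσ _ q hq, show ((q.2 : M) : ℕ) = m from h2, h1]
    -- The list pairing `a` with `b` is stage `0` of the chain, and `σ` extends every stage.
    · rw [List.map_map]
      exact List.map_congr_left fun q hq => (hσ 0 q (hW0 ▸ hq)).symm
    · obtain ⟨Z', h1, h2, hiso⟩ := clSim_iff.1 hcl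
      -- A list of pairs is determined by its two coordinate lists, so the partial isomorphism given
      -- by `≈` is the starting position.
      have hZ' : Z' = Z := by
        have key : ∀ X : List (M × M), (X.map Prod.fst).zip (X.map Prod.snd) = X := fun X => by
          rw [List.zip_map', List.map_id']
        rw [← key Z', h1, h2, key]
      exact exists_automorphism_of_chain hWc
        (fun n => onCodes_map.1 ((hYpos n).2 (onCodes_map.2 (hZ' ▸ hiso))).1) hW1 σ hσ

end Main

end CompFraisse

theorem mainTheorem10 {L : FirstOrder.Language.{u, v}} (ρ : CompFraisse.LanguageRep L)
    (M : Set ℕ) [L.Structure M] (hM : CompFraisse.IsComputableStructure ρ M)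
    (hU : CompFraisse.CofinallyUltrahomogeneous L M) :
    CompFraisse.ComputablyCofinallyUltrahomogeneous L
      (CompFraisse.jump (CompFraisse.jump (CompFraisse.jump ∅))) M :=
  CompFraisse.computablyCofinallyUltrahomogeneous_jump hM hU
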